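/- Let $\omega=\mathbb{N}$. For $r>0$ let $\mathrm{TFAb}_r$ be the class of torsion-free abelian groups of rank $r$ with universe $\omega$, in the signature $\{+\}$, and let $\mathrm{FD}_r$ be the class of fields of characteristic $0$ and transcendence degree $r$ over $\mathbb{Q}$ with universe $\omega$, in the signature $\{+,\cdot\}$. Structures are identified with their atomic diagrams, which are elements of $2^\omega$. **Theorem.** There are two Turing functionals $P,Q$ (oracle programs, each receiving $r$ as part of its input) such that for every $r>0$ they compute a functorial Turing-computable embedding $(\Phi,\Phi_*)$ of $\mathrm{TFAb}_r$ into $\mathrm{FD}_r$. That is: 1. for every $G\in\mathrm{TFAb}_r$, the program $P$ with oracle the atomic diagram of $G$ computes the atomic diagram of a field $\Phi(G)\in\mathrm{FD}_r$; 2. for every isomorphism $f:G\to G'$ of groups in $\mathrm{TFAb}_r$, the program $Q$ with oracle $G\oplus f\oplus G'$ computes a field isomorphism $\Phi_*(f):\Phi(G)\to\Phi(G')$; moreover $\Phi_*(\mathrm{id}_G)=\mathrm{id}_{\Phi(G)}$ and $\Phi_*(g\circ f)=\Phi_*(g)\circ\Phi_*(f)$; 3. for all $G,G'\in\mathrm{TFAb}_r$: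 $G\cong G'$ if and only if $\Phi(G)\cong\Phi(G')$. Moreover, $\Phi(G)$ is (identified by an isomorphism with) the fraction field of the group ring $\mathbb{Q}[G]$. Writing $Y_g\in\Phi(G)$ for the monomial of $g\in G$ (so $Y_gY_h=Y_{g+h}$ and $Y_0=1$), and likewise $Y_{g'}\in\Phi(G')$ for $g'\in G'$, one has $\Phi_*(f)(Y_g)=Y_{f(g)}$ for every isomorphism $f:G\to G'$ and every $g\in G$. Finally, for all $G,G'\in\mathrm{TFAb}_r$ and every field isomorphism $\varphi:\Phi(G)\to\Phi(G')$, put $$H=\{g\in G:\varphi(Y_g)=c\,Y_{g'}\text{ for some }c\in\mathbb{Q},\ g'\in G'\},\qquad H'=\{g'\in G':\varphi^{-1}(Y_{g'})=c\,Y_g\text{ for some }c\in\mathbb{Q},\ g\in G\}.$$ Then $H$ and $H'$ are pure subgroups of $G$ and $G'$ (a subgroup $H\le G$ is pure if $mg\in H$ with $m\in\mathbb{Z}\setminus\{0\}$ implies $g\in H$), there is an isomorphism $e:H\to H'$ such that $\varphi(Y_h)\in\mathbb{Q}\,Y_{e(h)}$ for every $h\in H$, and for some $k\in\mathbb{N}$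 there are internal direct sum decompositions $G=H\oplus K$ and $G'=H'\oplus K'$ with $K\cong K'\cong\mathbb{Z}^k$. In particular $G\cong G'$. -/

import Mathlib

/-! ### Turing functionals -/

/-- A (partial) Turing functional takes an oracle `A : ℕ → ℕ` and an input and, where it halts,
returns a natural number.  The functionals are generated by the basic functions, the query
`n ↦ A n`, and closure under pairing, composition, primitive recursion and `μ`-recursion, uniformly
in the oracle: this is Mathlib's `Nat.RecursiveIn`, with one derivation (program) serving all
oracles. -/
inductive IsTuringFunctional : ((ℕ → ℕ) → ℕ →. ℕ) → Prop
  | zero : IsTuringFunctional fun _ _ => Part.some 0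
  | succ : IsTuringFunctional fun _ n => Part.some (n + 1)
  | left : IsTuringFunctional fun _ n => Part.some n.unpair.1
  | right : IsTuringFunctional fun _ n => Part.some n.unpair.2
  | query : IsTuringFunctional fun A n => Part.some (A n)
  | pair {P Q : (ℕ → ℕ) → ℕ →. ℕ} (hP : IsTuringFunctional P) (hQ : IsTuringFunctional Q) :
      IsTuringFunctional fun A n => Nat.pair <$> P A n <*> Q A n
  | comp {P Q : (ℕ → ℕ) → ℕ →. ℕ} (hP : IsTuringFunctional P) (hQ : IsTuringFunctional Q) :
      IsTuringFunctional fun A n => Q A n >>= P A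
  | prec {P Q : (ℕ → ℕ) → ℕ →. ℕ} (hP : IsTuringFunctional P) (hQ : IsTuringFunctional Q) :
      IsTuringFunctional fun A p =>
        let (a, n) := Nat.unpair p
        n.rec (P A a) fun y IH => do
          let i ← IH
          Q A (Nat.pair a (Nat.pair y i))
  | rfind {P : (ℕ → ℕ) → ℕ →. ℕ} (hP : IsTuringFunctional P) :
      IsTuringFunctional fun A a =>
        Nat.rfind fun n => (fun m => decide (m = 0)) <$> P A (Nat.pair a n)

/-- The join `A ⊕ B` of two oracles. -/
def oracleJoin (A B : ℕ → ℕ) (n : ℕ) : ℕ :=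
  if n % 2 = 0 then A (n / 2) else B (n / 2)

/-! ### The two classes of structures with universe `ω` -/

/-- Torsion-free of rank `r`: a maximal linearly independent set over `ℤ` has `r` elements. -/
def IsTorsionFreeOfRank (r : ℕ) (G : Type) [AddCommGroup G] : Prop :=
  IsAddTorsionFree G ∧ Module.rank ℤ G = r

/-- Characteristic `0` and transcendence degree `r` over the prime field `ℚ`. -/
def IsCharZeroOfTrdeg (r : ℕ) (F : Type) [Field F] : Prop :=
  ∃ _ : CharZero F, Algebra.trdeg ℚ F = r

/-- `TFAb_r`: the torsion-free abelian groups of rank `r` with universe `ω`.  (The zero, the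
negation and the integer multiples carried by `AddCommGroup` are determined by the addition.) -/
structure TFAb (r : ℕ) where
  group : AddCommGroup ℕ
  isTorsionFreeOfRank : @IsTorsionFreeOfRank r ℕ group

/-- `FD_r`: the fields of characteristic `0` and transcendence degree `r` with universe `ω`. -/
structure FD (r : ℕ) where
  field : Field ℕ
  isCharZeroOfTrdeg : @IsCharZeroOfTrdeg r ℕ field

namespace TFAb

variable {r : ℕ}

/-- The universe `ω` of `G`, as a type that carries the group structure of `G` only. -/
def Carrier (_G : TFAb r) : Type := ℕ

instance : CoeSort (TFAb r) Type := ⟨Carrier⟩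

instance (G : TFAb r) : AddCommGroup G := G.group

/-- The natural number `n`, as an element of `G`. -/
def elt (G : TFAb r) : ℕ ≃ G := Equiv.refl ℕ

/-- The atomic diagram of `G` in the signature `{+}`, as an element of `2^ω`: the sentence
`a + b = c` has number `⟨a, ⟨b, c⟩⟩`. -/
def diagram (G : TFAb r) (n : ℕ) : ℕ :=
  if G.elt.symm (G.elt n.unpair.1 + G.elt n.unpair.2.unpair.1) = n.unpair.2.unpair.2
  then 1 else 0

end TFAb

namespace FD

variable {r : ℕ}

/-- The universe `ω` of `F`, as a type that carries the field structure of `F` only. -/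
def Carrier (_F : FD r) : Type := ℕ

instance : CoeSort (FD r) Type := ⟨Carrier⟩

instance (F : FD r) : Field F := F.field

/-- The natural number `n`, as an element of `F`. -/
def elt (F : FD r) : ℕ ≃ F := Equiv.refl ℕ

/-- The part of the atomic diagram of `F` that describes the addition. -/
def addDiagram (F : FD r) (n : ℕ) : ℕ :=
  if F.elt.symm (F.elt n.unpair.1 + F.elt n.unpair.2.unpair.1) = n.unpair.2.unpair.2
  then 1 else 0

/-- The part of the atomic diagram of `F` that describes the multiplication. -/
def mulDiagram (F : FD r) (n : ℕ) : ℕ :=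
  if F.elt.symm (F.elt n.unpair.1 * F.elt n.unpair.2.unpair.1) = n.unpair.2.unpair.2
  then 1 else 0

/-- The atomic diagram of `F` in the signature `{+, ·}`, as an element of `2^ω`. -/
def diagram (F : FD r) : ℕ → ℕ := oracleJoin F.addDiagram F.mulDiagram

end FD

/-- A group isomorphism, as a function on the universe `ω`. -/
def TFAb.isoFun {r : ℕ} {G G' : TFAb r} (f : G ≃+ G') (n : ℕ) : ℕ := G'.elt.symm (f (G.elt n))

/-- A field isomorphism, as a function on the universe `ω`. -/
def FD.isoFun {r : ℕ} {F F' : FD r} (f : F ≃+* F') (n : ℕ) : ℕ := F'.elt.symm (f (F.elt n))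

/-! ### Functorial Turing-computable embeddings -/

/-- The maps `Φ` on structures and `Φs` on isomorphisms form a functorial Turing-computable
embedding of `TFAb_r` into `FD_r`, computed by the functionals `P` and `Q`, both of which are given
the rank `r` along with their input. -/
structure IsFunctorialTCEmbedding (r : ℕ) (P Q : (ℕ → ℕ) → ℕ →. ℕ) (Φ : TFAb r → FD r)
    (Φs : ∀ G G' : TFAb r, (G ≃+ G') → (Φ G ≃+* Φ G')) : Prop where
  /-- `P`, with oracle `G`, computes the atomic diagram of `Φ(G)`. -/
  computes_obj : ∀ (G : TFAb r) (n : ℕ),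
    P G.diagram (Nat.pair r n) = Part.some ((Φ G).diagram n)
  /-- `Q`, with oracle `G ⊕ f ⊕ G'`, computes the isomorphism `Φ(G) → Φ(G')`. -/
  computes_map : ∀ (G G' : TFAb r) (f : G ≃+ G') (n : ℕ),
    Q (oracleJoin (oracleJoin G.diagram (TFAb.isoFun f)) G'.diagram) (Nat.pair r n) =
      Part.some (FD.isoFun (Φs G G' f) n)
  map_refl : ∀ G : TFAb r, Φs G G (AddEquiv.refl G) = RingEquiv.refl (Φ G)
  map_trans : ∀ (G G' G'' : TFAb r) (f : G ≃+ G') (g : G' ≃+ G''),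
    Φs G G'' (f.trans g) = (Φs G G' f).trans (Φs G' G'' g)
  iso_iff : ∀ G G' : TFAb r, Nonempty (G ≃+ G') ↔ Nonempty (Φ G ≃+* Φ G')

/-! ### Group rings, monomials, pure subgroups -/

/-- The fraction field of the group ring `ℚ[G]`. -/
abbrev GroupRingFractions {r : ℕ} (G : TFAb r) : Type :=
  FractionRing (AddMonoidAlgebra ℚ G)

/-- The monomial `Y_g`. -/
noncomputable def monomialY {r : ℕ} (G : TFAb r) (g : G) : GroupRingFractions G :=
  algebraMap (AddMonoidAlgebra ℚ G) (GroupRingFractions G) (AddMonoidAlgebra.single g 1)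

/-- A subgroup `H` is pure if `k g ∈ H` with `k ≠ 0` implies `g ∈ H`. -/
def IsPureAddSubgroup {G : Type} [AddCommGroup G] (H : AddSubgroup G) : Prop :=
  ∀ (k : ℤ) (g : G), k ≠ 0 → k • g ∈ H → g ∈ H

/-- `G = H ⊕ K` (an internal direct sum) for some subgroup `K` isomorphic to `ℤ^k`. -/
def HasFreeComplement {G : Type} [AddCommGroup G] (H : AddSubgroup G) (k : ℕ) : Prop :=
  ∃ K : AddSubgroup G, IsCompl H K ∧ Nonempty (K ≃+ (Fin k → ℤ))

/-!
# Torsion-free abelian groups of finite rank and fields of finite transcendence degree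

The functor sends a group `G` to the field of fractions `K(G)` of the group ring `ℚ[G]`.

**Computability.** An element of `K(G)` is a quotient of two differences of sums of monomials, so
it is coded by four lists of elements of `G`. Equality, sums and products of coded elements are
tested by multiplying out and comparing lists up to permutation, which needs only the addition of
`G`, and the addition is found by search in the atomic diagram. The codes that are not equal to an
earlier one enumerate `K(G)` without repetitions (`FracCode.enumeration`), and the transport of the
field structure along this enumeration is the field `fractionField G` with universe `ℕ`. An
isomorphism `f` of groups acts by renaming the entries of codes. `UniformlyComputable` is the notion
of computability, by one functional for a whole family of oracles, in which these constructions are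
carried out.

**Rigidity.** Let `φ : K(G) ≃ K(G')`, and let `H` be the group of those `g` for which `φ` maps `Y_g`
to a rational multiple of a monomial. Purity of `H` and the existence of a free complement both
follow once `G / H` is embedded into a free abelian group: the kernel of a homomorphism from a group
of finite rank to a free abelian group is pure, and the image is free and finitely generated, so
that the homomorphism splits (`exists_hasFreeComplement_ker`). For the embedding, choose a lattice
`L` in `G'`, of full rank, such that the images under `φ` of the monomials of a maximal independent
family of `G` are rational functions in the monomials of `L`. Every `φ(Y_g)` then has a power in the
field `K(L)` of such rational functions.

* Such an element of `K(G')` is the product of a monomial and an element of `K(L)`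
  (`exists_eq_fieldMonomial_mul_of_pow_mem`). After clearing denominators, this says that an element
  of `ℚ[G']` with a power in `K(L)` is supported on a single coset of `L`; indeed every complex
  character of `G'` that is trivial on `L` multiplies it by a root of unity, and such characters
  separate the cosets (`sub_mem_closure_of_pow_mul_eq`).
* `K(L)` is the field of fractions of a polynomial ring over `ℚ` whose variables are monomials. The
  multiplicities of the irreducible factors other than the variables define a homomorphism to a free
  abelian group that is trivial exactly on the rational multiples of monomials. It is well defined
  modulo monomials of all of `G'`, because each of them has a power in `K(L)`
  (`exists_addMonoidHom_of_mem_ratFunctions`).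

The same applies to the inverse of `φ`, and the matching of monomials is an isomorphism from `H` to
`H'`. Comparing ranks, the complements of `H` and `H'` are isomorphic, hence so are `G` and `G'`.
-/

/-! ### Group algebras of torsion-free groups -/

/-- Torsion-free abelian groups embed into rational vector spaces, which have unique sums; hence
their group algebras are domains. -/
instance IsAddTorsionFree.uniqueSums {G : Type*} [AddCommGroup G] [IsAddTorsionFree G] :
    UniqueSums G :=
  UniqueSums.of_injective_addHom (DivisibleHull.coeAddMonoidHom (M := G)).toAddHom
    DivisibleHull.coe_injective inferInstance

section Monomials

variable {G ι : Type*} [AddCommGroup G]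

/-- The element `∑ i, e i • b i` of `G` with exponent vector `e`. -/
noncomputable def exponentSum (b : ι → G) : (ι →₀ ℕ) →+ G :=
  (Finsupp.linearCombination ℕ b).toAddMonoidHom

theorem exponentSum_injective {b : ι → G} (hb : LinearIndependent ℤ b) :
    Function.Injective (exponentSum b) := by
  have h : LinearIndependent ℕ b := hb.restrict_scalars (R := ℕ)
    (fun m n h => by simpa using h)
  exact linearIndependent_iff_injective_finsuppLinearCombination.1 h

@[simp] theorem exponentSum_single (b : ι → G) (i : ι) (n : ℕ) :
    exponentSum b (Finsupp.single i n) = n • b i := by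
  simp [exponentSum]

/-- The embedding of polynomial rings into group algebras that sends the variable `X i` to the
monomial of `b i`. -/
noncomputable def polyHom (b : ι → G) : MvPolynomial ι ℚ →ₐ[ℚ] AddMonoidAlgebra ℚ G :=
  MvPolynomial.aeval fun i => AddMonoidAlgebra.single (b i) 1

@[simp] theorem polyHom_X (b : ι → G) (i : ι) :
    polyHom b (MvPolynomial.X i) = AddMonoidAlgebra.single (b i) 1 := by
  simp [polyHom]

theorem polyHom_monomial (b : ι → G) (e : ι →₀ ℕ) (q : ℚ) :
    polyHom b (MvPolynomial.monomial e q) = AddMonoidAlgebra.single (exponentSum b e) q := by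
  classical
  rw [polyHom, MvPolynomial.aeval_monomial, AddMonoidAlgebra.coe_algebraMap]
  have : (e.prod fun i n => (AddMonoidAlgebra.single (b i) (1 : ℚ)) ^ n) =
      AddMonoidAlgebra.single (exponentSum b e) 1 := by
    induction e using Finsupp.induction_linear with
    | zero => simp [AddMonoidAlgebra.one_def]
    | add f g hf hg =>
      rw [Finsupp.prod_add_index' (by simp) (by intros; rw [pow_add]), hf, hg, map_add,
        AddMonoidAlgebra.single_mul_single, mul_one]
    | single i n => simp [AddMonoidAlgebra.single_pow]
  rw [this]
  simp [AddMonoidAlgebra.single_mul_single]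

theorem polyHom_injective {b : ι → G} (hb : LinearIndependent ℤ b) :
    Function.Injective (polyHom b) := by
  have key : ∀ p : MvPolynomial ι ℚ, polyHom b p =
      AddMonoidAlgebra.mapDomain (exponentSum b) (show AddMonoidAlgebra ℚ (ι →₀ ℕ) from p) := by
    intro p
    induction p using MvPolynomial.induction_on' with
    | monomial e q =>
      rw [polyHom_monomial]
      exact (AddMonoidAlgebra.mapDomain_single ..).symm
    | add p q hp hq =>
      rw [map_add, hp, hq]
      exact (AddMonoidAlgebra.mapDomain_add ..).symm
  intro p q h
  rw [key, key] at h
  exact AddMonoidAlgebra.mapDomain_injective (exponentSum_injective hb) h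

/-- Modulo monomials in the variables, the monomial of an element of the lattice spanned by `b` is
a monomial in the variables. -/
theorem exists_add_exponentSum_eq {b : ι → G} {l : G}
    (hl : l ∈ AddSubgroup.closure (Set.range b)) :
    ∃ e f : ι →₀ ℕ, l + exponentSum b f = exponentSum b e := by
  induction hl using AddSubgroup.closure_induction with
  | mem x hx =>
    obtain ⟨i, rfl⟩ := hx
    exact ⟨Finsupp.single i 1, 0, by simp⟩
  | zero => exact ⟨0, 0, by simp⟩
  | add x y _ _ hx hy =>
    obtain ⟨e, f, h⟩ := hx
    obtain ⟨e', f', h'⟩ := hy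
    exact ⟨e + e', f + f', by rw [map_add, map_add, ← h, ← h']; abel⟩
  | neg x _ hx =>
    obtain ⟨e, f, h⟩ := hx
    exact ⟨f, e, by rw [← h]; abel⟩

/-- Elements of the group algebra supported on the lattice spanned by `b` are Laurent polynomials in
the variables. -/
theorem exists_mul_polyHom_monomial_eq {b : ι → G} (a : AddMonoidAlgebra ℚ G)
    (ha : ∀ g ∈ a.coeff.support, g ∈ AddSubgroup.closure (Set.range b)) :
    ∃ (f : ι →₀ ℕ) (p : MvPolynomial ι ℚ),
      a * polyHom b (MvPolynomial.monomial f 1) = polyHom b p := by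
  rw [← AddMonoidAlgebra.sum_coeff_single a, Finsupp.sum]
  refine Finset.sum_induction _ (fun a => ∃ (f : ι →₀ ℕ) (p : MvPolynomial ι ℚ),
      a * polyHom b (MvPolynomial.monomial f 1) = polyHom b p) ?_ ⟨0, 0, by simp⟩ ?_
  · rintro x y ⟨f, p, h⟩ ⟨f', p', h'⟩
    refine ⟨f + f', p * MvPolynomial.monomial f' 1 + p' * MvPolynomial.monomial f 1, ?_⟩
    have : (MvPolynomial.monomial (f + f')) (1 : ℚ) =
        MvPolynomial.monomial f 1 * MvPolynomial.monomial f' 1 := by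
      simp [MvPolynomial.monomial_mul]
    rw [this, map_add, map_mul, map_mul, map_mul, ← h, ← h']
    ring
  · intro g hg
    obtain ⟨e, f, h⟩ := exists_add_exponentSum_eq (ha g hg)
    exact ⟨f, MvPolynomial.monomial e (a.coeff g), by
      rw [polyHom_monomial, polyHom_monomial, AddMonoidAlgebra.single_mul_single, h, mul_one]⟩

variable [IsAddTorsionFree G]

/-- If `b` spans a lattice with torsion quotient, then the group algebra is algebraic over the
polynomial ring, so denominators can be chosen to be polynomials. -/
theorem exists_mul_eq_polyHom {b : ι → G}
    (ht : ∀ g : G, ∃ n : ℕ, n ≠ 0 ∧ n • g ∈ AddSubgroup.closure (Set.range b))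
    {a : AddMonoidAlgebra ℚ G} (ha : a ≠ 0) :
    ∃ (c : AddMonoidAlgebra ℚ G) (p : MvPolynomial ι ℚ), p ≠ 0 ∧ a * c = polyHom b p := by
  let _ : Algebra (MvPolynomial ι ℚ) (AddMonoidAlgebra ℚ G) := (polyHom b).toRingHom.toAlgebra
  have hmap : ∀ p, algebraMap (MvPolynomial ι ℚ) (AddMonoidAlgebra ℚ G) p = polyHom b p :=
    fun _ => rfl
  have hlat : ∀ l ∈ AddSubgroup.closure (Set.range b),
      IsAlgebraic (MvPolynomial ι ℚ) (AddMonoidAlgebra.single l (1 : ℚ)) := by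
    intro l hl
    obtain ⟨e, f, h⟩ := exists_add_exponentSum_eq hl
    refine ⟨Polynomial.C (MvPolynomial.monomial f 1) * Polynomial.X -
      Polynomial.C (MvPolynomial.monomial e 1), fun h0 => ?_, ?_⟩
    · have := congrArg (Polynomial.coeff · 1) h0
      simp [Polynomial.coeff_C] at this
    · simp only [map_sub, map_mul, Polynomial.aeval_C, Polynomial.aeval_X, hmap, polyHom_monomial,
        AddMonoidAlgebra.single_mul_single, mul_one]
      rw [add_comm, h, sub_self]
  have hsingle : ∀ g : G, IsAlgebraic (MvPolynomial ι ℚ) (AddMonoidAlgebra.single g (1 : ℚ)) := by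
    intro g
    obtain ⟨n, hn, hg⟩ := ht g
    refine IsAlgebraic.of_pow (Nat.pos_of_ne_zero hn) ?_
    rw [AddMonoidAlgebra.single_pow, one_pow]
    exact hlat _ hg
  have hall : ∀ a : AddMonoidAlgebra ℚ G, IsAlgebraic (MvPolynomial ι ℚ) a := by
    intro a
    induction a using AddMonoidAlgebra.induction_linear with
    | zero => exact isAlgebraic_zero
    | add x y hx hy => exact hx.add hy
    | single g q =>
      have : AddMonoidAlgebra.single g q = algebraMap (MvPolynomial ι ℚ) (AddMonoidAlgebra ℚ G)
          (MvPolynomial.C q) * AddMonoidAlgebra.single g 1 := by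
        rw [hmap, ← MvPolynomial.monomial_zero', polyHom_monomial,
          AddMonoidAlgebra.single_mul_single]
        simp
      rw [this]
      exact (isAlgebraic_algebraMap _).mul (hsingle g)
  obtain ⟨p, hp, c, hc⟩ := (hall a).exists_nonzero_dvd (mem_nonZeroDivisors_of_ne_zero ha)
  exact ⟨c, p, hp, by rw [← hc, hmap]⟩

end Monomials

/-! ### Characters and homogeneous elements -/

/-- The embedding `q ↦ exp (2πiq)` of `ℚ/ℤ` into the unit circle. -/
noncomputable def ratCircle : AddCircle (1 : ℚ) →+ Additive Circle :=
  QuotientAddGroup.lift (AddSubgroup.zmultiples (1 : ℚ))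
    ((AddMonoidHom.mk'
      (fun q : ℚ => Additive.ofMul (AddCircle.toCircle ((q : ℝ) : AddCircle (1 : ℝ))))
      (fun p q => by
        rw [← ofMul_mul, ← AddCircle.toCircle_add, Rat.cast_add, AddCircle.coe_add])))
    (by
      intro q hq
      obtain ⟨n, rfl⟩ := AddSubgroup.mem_zmultiples_iff.1 hq
      have : (((n • (1 : ℚ) : ℚ) : ℝ) : AddCircle (1 : ℝ)) = 0 := by
        rw [AddCircle.coe_eq_zero_iff]
        exact ⟨n, by simp⟩
      change Additive.ofMul
        (AddCircle.toCircle (((n • (1 : ℚ) : ℚ) : ℝ) : AddCircle (1 : ℝ))) = 0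
      rw [this, AddCircle.toCircle_zero, ofMul_one])

theorem ratCircle_eq_zero {x : AddCircle (1 : ℚ)} (h : ratCircle x = 0) : x = 0 := by
  induction x using QuotientAddGroup.induction_on with
  | H q =>
    have h1 : AddCircle.toCircle ((q : ℝ) : AddCircle (1 : ℝ)) = 1 := h
    have h2 : ((q : ℝ) : AddCircle (1 : ℝ)) = 0 :=
      AddCircle.injective_toCircle one_ne_zero (h1.trans AddCircle.toCircle_zero.symm)
    rw [AddCircle.coe_eq_zero_iff] at h2
    obtain ⟨n, hn⟩ := h2
    refine (AddCircle.coe_eq_zero_iff (1 : ℚ)).2 ⟨n, ?_⟩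
    have : ((n : ℚ) : ℝ) = (q : ℝ) := by simpa using hn
    simpa using Rat.cast_injective this

/-- Complex characters that are trivial on a subgroup `L` separate the elements outside `L`. -/
theorem exists_character_ne_one {G : Type*} [AddCommGroup G] (L : AddSubgroup G) {g : G}
    (hg : g ∉ L) :
    ∃ χ : Multiplicative G →* ℂ, (∀ l ∈ L, χ (Multiplicative.ofAdd l) = 1) ∧
      χ (Multiplicative.ofAdd g) ≠ 1 := by
  have hne : (QuotientAddGroup.mk g : G ⧸ L) ≠ 0 := by
    rwa [Ne, QuotientAddGroup.eq_zero_iff]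
  obtain ⟨c, hc⟩ := CharacterModule.exists_character_apply_ne_zero_of_ne_zero hne
  let ψ : G →+ Additive Circle :=
    (ratCircle.comp (c : (G ⧸ L) →+ AddCircle (1 : ℚ))).comp (QuotientAddGroup.mk' L)
  refine ⟨Circle.coeHom.comp (AddMonoidHom.toMultiplicativeLeft ψ), fun l hl => ?_, fun h => ?_⟩
  · have : ψ l = 0 := by
      have : (QuotientAddGroup.mk' L) l = 0 := (QuotientAddGroup.eq_zero_iff l).2 hl
      simp only [ψ, AddMonoidHom.comp_apply, this, map_zero]
    change ((Additive.toMul (ψ l) : Circle) : ℂ) = 1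
    rw [this]; rfl
  · have h1 : ((Additive.toMul (ψ g) : Circle) : ℂ) = 1 := h
    have h2 : ψ g = 0 := by
      have : Additive.toMul (ψ g) = 1 := Circle.ext (by simpa using h1)
      simpa using congrArg Additive.ofMul this
    exact hc (ratCircle_eq_zero h2)

section Homogeneous

variable {G ι : Type*} [AddCommGroup G]

/-- The twist `∑ q_g Y_g ↦ ∑ q_g χ(g) Y_g` of the group algebra by a character `χ`, with complex
coefficients. -/
noncomputable def twistHom (χ : Multiplicative G →* ℂ) :
    AddMonoidAlgebra ℚ G →ₐ[ℚ] AddMonoidAlgebra ℂ G :=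
  AddMonoidAlgebra.lift ℚ (AddMonoidAlgebra ℂ G) G
    { toFun := fun g => AddMonoidAlgebra.single g.toAdd (χ g)
      map_one' := by simp [AddMonoidAlgebra.one_def]
      map_mul' := fun g h => by simp [AddMonoidAlgebra.single_mul_single] }

theorem twistHom_single (χ : Multiplicative G →* ℂ) (g : G) (q : ℚ) :
    twistHom χ (AddMonoidAlgebra.single g q) =
      AddMonoidAlgebra.single g (q * χ (Multiplicative.ofAdd g)) := by
  simp [twistHom, AddMonoidAlgebra.lift_single, AddMonoidAlgebra.smul_single, Rat.smul_def]

theorem coeff_twistHom (χ : Multiplicative G →* ℂ) (a : AddMonoidAlgebra ℚ G) (g : G) :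
    (twistHom χ a).coeff g = a.coeff g * χ (Multiplicative.ofAdd g) := by
  classical
  induction a using AddMonoidAlgebra.induction_linear with
  | zero => simp
  | add x y hx hy => simp [hx, hy, add_mul]
  | single h q =>
    rw [twistHom_single, AddMonoidAlgebra.coeff_single, AddMonoidAlgebra.coeff_single,
      Finsupp.single_apply, Finsupp.single_apply]
    split_ifs with e
    · rw [e]
    · simp

theorem twistHom_polyHom (χ : Multiplicative G →* ℂ) (b : ι → G)
    (h : ∀ i, χ (Multiplicative.ofAdd (b i)) = 1) (p : MvPolynomial ι ℚ) :
    twistHom χ (polyHom b p) = twistHom 1 (polyHom b p) := by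
  have : (twistHom χ).comp (polyHom b) = (twistHom 1).comp (polyHom b) := by
    ext i : 1
    simp [twistHom_single, h]
  exact DFunLike.congr_fun this p

/-- Elements with equal `n`-th powers differ by a complex root of unity: the group algebra is a
domain that contains `ℂ`, so `x ^ n - y ^ n` splits into linear factors. -/
theorem eq_smul_of_pow_eq_pow [IsAddTorsionFree G] {x y : AddMonoidAlgebra ℂ G} {n : ℕ}
    (hn : 0 < n) (h : x ^ n = y ^ n) : ∃ ζ : ℂ, x = ζ • y := by
  have hζ := Complex.isPrimitiveRoot_exp n hn.ne'
  have hinj : Function.Injective (algebraMap ℂ (AddMonoidAlgebra ℂ G)) :=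
    (algebraMap ℂ (AddMonoidAlgebra ℂ G)).injective
  have hζ' := hζ.map_of_injective hinj
  have h0 := hζ'.pow_sub_pow_eq_prod_sub_mul x y hn
  rw [h, sub_self, eq_comm, Finset.prod_eq_zero_iff] at h0
  obtain ⟨η, hη, h1⟩ := h0
  rw [Polynomial.mem_nthRootsFinset hn] at hη
  have : NeZero n := ⟨hn.ne'⟩
  obtain ⟨i, -, rfl⟩ := hζ'.eq_pow_of_pow_eq_one hη
  refine ⟨Complex.exp (2 * Real.pi * Complex.I / n) ^ i, ?_⟩
  rw [sub_eq_zero.1 h1, Algebra.smul_def, map_pow]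

/-- An element of the group algebra with a power that is, up to a polynomial factor, a polynomial
in the monomials of `b` is supported on a single coset of the lattice spanned by `b`: every
character that is trivial on the lattice multiplies the element by a root of unity. -/
theorem sub_mem_closure_of_pow_mul_eq [IsAddTorsionFree G] {b : ι → G}
    (hb : LinearIndependent ℤ b) {a : AddMonoidAlgebra ℚ G} {n : ℕ} (hn : 0 < n)
    {d e : MvPolynomial ι ℚ} (hd : d ≠ 0) (h : a ^ n * polyHom b d = polyHom b e) {g g' : G}
    (hg : g ∈ a.coeff.support) (hg' : g' ∈ a.coeff.support) :
    g - g' ∈ AddSubgroup.closure (Set.range b) := by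
  by_contra hL
  obtain ⟨χ, hχ, hne⟩ := exists_character_ne_one _ hL
  have hχb : ∀ i, χ (Multiplicative.ofAdd (b i)) = 1 := fun i =>
    hχ _ (AddSubgroup.subset_closure ⟨i, rfl⟩)
  have hinj : Function.Injective (twistHom (1 : Multiplicative G →* ℂ)) := by
    intro x y hxy
    refine AddMonoidAlgebra.coeff_injective (Finsupp.ext fun k => ?_)
    have := congrArg (fun z => z.coeff k) hxy
    simpa [coeff_twistHom] using this
  have hd0 : twistHom (1 : Multiplicative G →* ℂ) (polyHom b d) ≠ 0 := by
    rw [Ne, map_eq_zero_iff _ hinj, map_eq_zero_iff _ (polyHom_injective hb)]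
    exact hd
  have hpow : twistHom χ a ^ n = twistHom 1 a ^ n := by
    refine mul_right_cancel₀ hd0 ?_
    rw [← map_pow (twistHom 1), ← map_mul (twistHom 1), h, ← twistHom_polyHom χ b hχb,
      ← twistHom_polyHom χ b hχb, ← map_pow, ← map_mul, h]
  obtain ⟨ζ, hζ⟩ := eq_smul_of_pow_eq_pow hn hpow
  have hval : ∀ k ∈ a.coeff.support, χ (Multiplicative.ofAdd k) = ζ := by
    intro k hk
    have h1 := congrArg (fun z => z.coeff k) hζ
    simp only [coeff_twistHom, AddMonoidAlgebra.coeff_smul, Finsupp.smul_apply, smul_eq_mul,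
      MonoidHom.one_apply, mul_one] at h1
    have hk0 : ((a.coeff k : ℚ) : ℂ) ≠ 0 := by
      simpa using Finsupp.mem_support_iff.1 hk
    rw [mul_comm ζ] at h1
    exact mul_left_cancel₀ hk0 h1
  refine hne ?_
  have hmul : χ (Multiplicative.ofAdd (g - g')) * χ (Multiplicative.ofAdd g') =
      χ (Multiplicative.ofAdd g) := by
    rw [← map_mul, ← ofAdd_add, sub_add_cancel]
  have hz : χ (Multiplicative.ofAdd g') ≠ 0 := by
    intro h0
    have h1 : χ (Multiplicative.ofAdd g') * χ (Multiplicative.ofAdd (-g')) = 1 := by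
      rw [← map_mul, ← ofAdd_add, add_neg_cancel, ofAdd_zero, map_one]
    rw [h0, zero_mul] at h1
    exact zero_ne_one h1
  rw [hval g hg, ← hval g' hg'] at hmul
  exact mul_right_cancel₀ hz (hmul.trans (one_mul _).symm)

end Homogeneous

/-! ### Factorizations of polynomials away from the variables -/

section Factors

open UniqueFactorizationMonoid

variable {ι : Type*}

/-- A choice of representatives for the irreducible polynomials up to units. -/
noncomputable local instance polynomialNormalizationMonoid :
    NormalizationMonoid (MvPolynomial ι ℚ) :=
  (UniqueFactorizationMonoid.strongNormalizationMonoid).toNormalizationMonoid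

open Classical in
/-- The multiplicities of the irreducible factors of a polynomial that are not associated to a
variable. -/
noncomputable def nonvariableFactors (p : MvPolynomial ι ℚ) : MvPolynomial ι ℚ →₀ ℤ :=
  Finsupp.mapRange.addMonoidHom (Nat.castAddMonoidHom ℤ) (Multiset.toFinsupp
    ((normalizedFactors p).filter fun x => ¬ ∃ i, Associated x (MvPolynomial.X i)))

theorem nonvariableFactors_mul {p q : MvPolynomial ι ℚ} (hp : p ≠ 0) (hq : q ≠ 0) :
    nonvariableFactors (p * q) = nonvariableFactors p + nonvariableFactors q := by
  simp only [nonvariableFactors, normalizedFactors_mul hp hq, Multiset.filter_add, map_add]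

@[simp] theorem nonvariableFactors_one :
    nonvariableFactors (1 : MvPolynomial ι ℚ) = 0 := by
  simp [nonvariableFactors]

theorem nonvariableFactors_C {c : ℚ} (hc : c ≠ 0) :
    nonvariableFactors (MvPolynomial.C c : MvPolynomial ι ℚ) = 0 := by
  rw [nonvariableFactors, normalizedFactors_of_isUnit ((IsUnit.mk0 c hc).map MvPolynomial.C)]
  simp

theorem nonvariableFactors_pow {p : MvPolynomial ι ℚ} (hp : p ≠ 0) (n : ℕ) :
    nonvariableFactors (p ^ n) = n • nonvariableFactors p := by
  induction n with
  | zero => simp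
  | succ n ih => rw [pow_succ, nonvariableFactors_mul (pow_ne_zero n hp) hp, ih, succ_nsmul]

theorem nonvariableFactors_X (i : ι) :
    nonvariableFactors (MvPolynomial.X i : MvPolynomial ι ℚ) = 0 := by
  have h : normalizedFactors (MvPolynomial.X i : MvPolynomial ι ℚ) =
      {normalize (MvPolynomial.X i)} :=
    normalizedFactors_irreducible (MvPolynomial.X_prime).irreducible
  rw [nonvariableFactors, h, Multiset.filter_singleton, if_neg, Multiset.empty_eq_zero, map_zero,
    map_zero]
  exact not_not.2 ⟨i, normalize_associated _⟩

theorem nonvariableFactors_monomial (e : ι →₀ ℕ) :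
    nonvariableFactors (MvPolynomial.monomial e (1 : ℚ)) = 0 := by
  induction e using Finsupp.induction_linear with
  | zero => exact nonvariableFactors_one
  | add f g hf hg =>
    have : MvPolynomial.monomial (f + g) (1 : ℚ) =
        MvPolynomial.monomial f 1 * MvPolynomial.monomial g 1 := by
      simp [MvPolynomial.monomial_mul]
    rw [this, nonvariableFactors_mul (by simp) (by simp), hf, hg, add_zero]
  | single i n =>
    rw [← MvPolynomial.X_pow_eq_monomial, nonvariableFactors_pow (MvPolynomial.X_ne_zero i),
      nonvariableFactors_X, smul_zero]

theorem prod_associated_monomial (s : Multiset (MvPolynomial ι ℚ))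
    (hs : ∀ x ∈ s, ∃ i, Associated x (MvPolynomial.X i)) :
    ∃ e, Associated s.prod (MvPolynomial.monomial e (1 : ℚ)) := by
  induction s using Multiset.induction_on with
  | empty => exact ⟨0, by simp⟩
  | cons x s ih =>
    obtain ⟨e, he⟩ := ih fun y hy => hs y (Multiset.mem_cons_of_mem hy)
    obtain ⟨i, hi⟩ := hs x (Multiset.mem_cons_self x s)
    refine ⟨Finsupp.single i 1 + e, ?_⟩
    have : MvPolynomial.monomial (Finsupp.single i 1 + e) (1 : ℚ) =
        MvPolynomial.X i * MvPolynomial.monomial e 1 := by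
      rw [MvPolynomial.X, MvPolynomial.monomial_mul, one_mul]
    rw [Multiset.prod_cons, this]
    exact hi.mul_mul he

theorem exists_eq_C_of_associated {p q : MvPolynomial ι ℚ} (h : Associated p q) :
    ∃ c : ℚ, p = MvPolynomial.C c * q := by
  obtain ⟨u, hu⟩ := h.symm
  obtain ⟨c, -, hc⟩ := MvPolynomial.isUnit_iff_eq_C_of_isReduced.1 u.isUnit
  exact ⟨c, by rw [← hu, hc, mul_comm]⟩

/-- Polynomials with the same irreducible factors away from the variables agree up to monomials
and constants. -/
theorem exists_mul_monomial_eq {p q : MvPolynomial ι ℚ} (hp : p ≠ 0) (hq : q ≠ 0)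
    (h : nonvariableFactors p = nonvariableFactors q) :
    ∃ (c : ℚ) (e f : ι →₀ ℕ),
      p * MvPolynomial.monomial f 1 = MvPolynomial.C c * (q * MvPolynomial.monomial e 1) := by
  classical
  have key : ∀ r : MvPolynomial ι ℚ, r ≠ 0 → ∃ e, Associated r
      (MvPolynomial.monomial e 1 * ((normalizedFactors r).filter
        fun x => ¬ ∃ i, Associated x (MvPolynomial.X i)).prod) := by
    intro r hr
    obtain ⟨e, he⟩ := prod_associated_monomial
      ((normalizedFactors r).filter fun x => ∃ i, Associated x (MvPolynomial.X i))
      (fun x hx => (Multiset.mem_filter.1 hx).2)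
    refine ⟨e, (prod_normalizedFactors hr).symm.trans ?_⟩
    rw [← Multiset.filter_add_not (fun x => ∃ i, Associated x (MvPolynomial.X i))
      (normalizedFactors r), Multiset.prod_add]
    refine he.mul_mul ?_
    rw [Multiset.filter_add_not]
    convert Associated.refl _
  obtain ⟨e, he⟩ := key p hp
  obtain ⟨f, hf⟩ := key q hq
  have hfac : (normalizedFactors p).filter (fun x => ¬ ∃ i, Associated x (MvPolynomial.X i)) =
      (normalizedFactors q).filter (fun x => ¬ ∃ i, Associated x (MvPolynomial.X i)) := by
    have hinj : Function.Injective (Finsupp.mapRange (α := MvPolynomial ι ℚ) (Nat.cast : ℕ → ℤ)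
      Nat.cast_zero) := Finsupp.mapRange_injective _ Nat.cast_zero Nat.cast_injective
    have h1 := Multiset.toFinsupp.injective (hinj h)
    convert h1
  rw [hfac] at he
  obtain ⟨c, hc⟩ := exists_eq_C_of_associated (p := p * MvPolynomial.monomial f 1)
    (q := q * MvPolynomial.monomial e 1) (by
      refine (he.mul_mul (Associated.refl _)).trans (Associated.trans ?_
        (hf.mul_mul (Associated.refl _)).symm)
      exact Associated.of_eq (by ring))
  exact ⟨c, e, f, hc⟩

end Factors

/-! ### Divisors of rational functions modulo monomials -/

section RationalFunctions

theorem charZero_of_algebra_addMonoidAlgebra (G K : Type*) [AddCommGroup G] [Field K]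
    [Algebra (AddMonoidAlgebra ℚ G) K] : CharZero K :=
  charZero_of_injective_ringHom (f := (algebraMap (AddMonoidAlgebra ℚ G) K).comp
      (AddMonoidAlgebra.singleZeroRingHom : ℚ →+* AddMonoidAlgebra ℚ G)) (RingHom.injective _)

variable {G ι : Type*} [AddCommGroup G]
variable (K : Type*) [Field K] [Algebra (AddMonoidAlgebra ℚ G) K]

/-- The monomial of `g` in the fraction field `K` of the group algebra. -/
noncomputable def fieldMonomial (g : G) : K :=
  algebraMap (AddMonoidAlgebra ℚ G) K (AddMonoidAlgebra.single g 1)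

theorem fieldMonomial_add (g h : G) :
    fieldMonomial K (g + h) = fieldMonomial K g * fieldMonomial K h := by
  rw [fieldMonomial, fieldMonomial, fieldMonomial, ← map_mul, AddMonoidAlgebra.single_mul_single,
    mul_one]

@[simp] theorem fieldMonomial_zero : fieldMonomial K (0 : G) = 1 := by
  rw [fieldMonomial, ← AddMonoidAlgebra.one_def, map_one]

theorem fieldMonomial_nsmul (n : ℕ) (g : G) :
    fieldMonomial K (n • g) = fieldMonomial K g ^ n := by
  induction n with
  | zero => simp
  | succ n ih => rw [succ_nsmul, fieldMonomial_add, ih, pow_succ]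

theorem algebraMap_single (g : G) (q : ℚ) [CharZero K] :
    algebraMap (AddMonoidAlgebra ℚ G) K (AddMonoidAlgebra.single g q) =
      (q : K) * fieldMonomial K g := by
  have h1 : AddMonoidAlgebra.single g q =
      AddMonoidAlgebra.single 0 q * AddMonoidAlgebra.single g (1 : ℚ) := by
    rw [AddMonoidAlgebra.single_mul_single, zero_add, mul_one]
  have h2 : algebraMap (AddMonoidAlgebra ℚ G) K (AddMonoidAlgebra.single 0 q) = (q : K) :=
    map_ratCast ((algebraMap (AddMonoidAlgebra ℚ G) K).comp
      AddMonoidAlgebra.singleZeroRingHom) q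
  rw [h1, map_mul, h2, fieldMonomial]

/-- The embedding of polynomial rings into the field of fractions that sends the variable `X i` to
the monomial of `b i`. -/
noncomputable def polyFieldHom (b : ι → G) : MvPolynomial ι ℚ →+* K :=
  (algebraMap (AddMonoidAlgebra ℚ G) K).comp (polyHom b).toRingHom

theorem polyFieldHom_apply (b : ι → G) (p : MvPolynomial ι ℚ) :
    polyFieldHom K b p = algebraMap (AddMonoidAlgebra ℚ G) K (polyHom b p) := rfl

theorem polyFieldHom_monomial (b : ι → G) (e : ι →₀ ℕ) :
    polyFieldHom K b (MvPolynomial.monomial e 1) = fieldMonomial K (exponentSum b e) := by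
  rw [polyFieldHom_apply, polyHom_monomial, fieldMonomial]

variable [IsFractionRing (AddMonoidAlgebra ℚ G) K]

theorem fieldMonomial_ne_zero (g : G) : fieldMonomial K g ≠ 0 := by
  rw [fieldMonomial, Ne, IsFractionRing.to_map_eq_zero_iff]
  simp

/-- Monomials of distinct elements are not proportional. -/
theorem eq_of_fieldMonomial_eq_mul [CharZero K] {g h : G} {c : ℚ}
    (e : fieldMonomial K g = (c : K) * fieldMonomial K h) : g = h := by
  rw [← algebraMap_single, fieldMonomial] at e
  have := IsFractionRing.injective (AddMonoidAlgebra ℚ G) K e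
  rcases AddMonoidAlgebra.single_inj.1 this with h | h
  · exact h.1
  · exact absurd h.1 one_ne_zero

theorem polyFieldHom_injective {b : ι → G} (hb : LinearIndependent ℤ b) :
    Function.Injective (polyFieldHom K b) :=
  (IsFractionRing.injective (AddMonoidAlgebra ℚ G) K).comp (polyHom_injective hb)

/-- The field of rational functions in the monomials of `b`. -/
noncomputable def ratFunctions {b : ι → G} (hb : LinearIndependent ℤ b) : Subfield K :=
  (IsFractionRing.lift (K := FractionRing (MvPolynomial ι ℚ))
    (polyFieldHom_injective K hb)).fieldRange

theorem mem_ratFunctions {b : ι → G} (hb : LinearIndependent ℤ b) {x : K} :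
    x ∈ ratFunctions K hb ↔
      ∃ p q : MvPolynomial ι ℚ, q ≠ 0 ∧ x * polyFieldHom K b q = polyFieldHom K b p := by
  constructor
  · rintro ⟨y, rfl⟩
    obtain ⟨p, q, hq, rfl⟩ := IsFractionRing.div_surjective (A := MvPolynomial ι ℚ) y
    have hq0 := nonZeroDivisors.ne_zero hq
    refine ⟨p, q, hq0, ?_⟩
    rw [map_div₀, IsFractionRing.lift_algebraMap, IsFractionRing.lift_algebraMap, div_mul_cancel₀]
    rwa [Ne, map_eq_zero_iff _ (polyFieldHom_injective K hb)]
  · rintro ⟨p, q, hq, h⟩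
    have hq0 : polyFieldHom K b q ≠ 0 := by
      rwa [Ne, map_eq_zero_iff _ (polyFieldHom_injective K hb)]
    refine ⟨algebraMap _ _ p / algebraMap _ _ q, ?_⟩
    rw [map_div₀, IsFractionRing.lift_algebraMap, IsFractionRing.lift_algebraMap, ← h,
      mul_div_cancel_right₀ _ hq0]

theorem fieldMonomial_mem_ratFunctions {b : ι → G} (hb : LinearIndependent ℤ b) {l : G}
    (hl : l ∈ AddSubgroup.closure (Set.range b)) : fieldMonomial K l ∈ ratFunctions K hb := by
  obtain ⟨e, f, h⟩ := exists_add_exponentSum_eq hl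
  refine (mem_ratFunctions K hb).2 ⟨MvPolynomial.monomial e 1, MvPolynomial.monomial f 1, by simp,
    ?_⟩
  rw [polyFieldHom_monomial, polyFieldHom_monomial, ← fieldMonomial_add, h]

theorem algebraMap_mem_ratFunctions {b : ι → G} (hb : LinearIndependent ℤ b)
    {a : AddMonoidAlgebra ℚ G}
    (ha : ∀ g ∈ a.coeff.support, g ∈ AddSubgroup.closure (Set.range b)) :
    algebraMap _ K a ∈ ratFunctions K hb := by
  obtain ⟨f, p, h⟩ := exists_mul_polyHom_monomial_eq a ha
  refine (mem_ratFunctions K hb).2 ⟨p, MvPolynomial.monomial f 1, by simp, ?_⟩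
  rw [polyFieldHom_apply, polyFieldHom_apply, ← h, map_mul]

/-- Polynomials that differ by monomials of `G`, in the field of fractions, have the same
irreducible factors away from the variables: a power of each monomial of `G` is a quotient of
monomials in the variables, and the multiplicities are integers. -/
theorem nonvariableFactors_eq_of_fieldMonomial_mul_eq {b : ι → G}
    (hb : LinearIndependent ℤ b)
    (ht : ∀ g : G, ∃ n : ℕ, n ≠ 0 ∧ n • g ∈ AddSubgroup.closure (Set.range b))
    {g h : G} {p q : MvPolynomial ι ℚ} (hp : p ≠ 0) (hq : q ≠ 0)
    (e : fieldMonomial K g * polyFieldHom K b p = fieldMonomial K h * polyFieldHom K b q) :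
    nonvariableFactors p = nonvariableFactors q := by
  obtain ⟨n, hn, hl⟩ := ht (g - h)
  obtain ⟨u, v, huv⟩ := exists_add_exponentSum_eq hl
  have h1 : MvPolynomial.monomial u 1 * p ^ n = MvPolynomial.monomial v 1 * q ^ n := by
    apply polyFieldHom_injective K hb
    refine mul_left_cancel₀ (fieldMonomial_ne_zero K (n • h)) ?_
    rw [map_mul, map_mul, map_pow, map_pow, polyFieldHom_monomial, polyFieldHom_monomial, ← huv,
      ← mul_assoc, ← fieldMonomial_add]
    have : n • h + (n • (g - h) + exponentSum b v) = n • g + exponentSum b v := by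
      rw [smul_sub]; abel
    rw [this, fieldMonomial_add, fieldMonomial_nsmul, fieldMonomial_nsmul]
    calc _ = fieldMonomial K (exponentSum b v) * (fieldMonomial K g * polyFieldHom K b p) ^ n := by
          ring
      _ = _ := by rw [e]; ring
  have h2 := congrArg nonvariableFactors h1
  rw [nonvariableFactors_mul (by simp) (pow_ne_zero n hp),
    nonvariableFactors_mul (by simp) (pow_ne_zero n hq), nonvariableFactors_monomial,
    nonvariableFactors_monomial, zero_add, zero_add, nonvariableFactors_pow hp,
    nonvariableFactors_pow hq] at h2
  exact nsmul_right_injective hn h2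

/-- The subgroup generated by the monomials and the rational functions in the monomials of a
lattice with torsion quotient is closed under roots. -/
theorem exists_eq_fieldMonomial_mul_of_pow_mem [IsAddTorsionFree G] {b : ι → G}
    (hb : LinearIndependent ℤ b)
    (ht : ∀ g : G, ∃ n : ℕ, n ≠ 0 ∧ n • g ∈ AddSubgroup.closure (Set.range b))
    {x : K} {n : ℕ} (hn : 0 < n) (hx : x ^ n ∈ ratFunctions K hb) :
    ∃ (g : G) (y : K), y ∈ ratFunctions K hb ∧ x = fieldMonomial K g * y := by
  obtain ⟨a, c, hc, rfl⟩ := IsFractionRing.div_surjective (A := AddMonoidAlgebra ℚ G) x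
  have hinj := IsFractionRing.injective (AddMonoidAlgebra ℚ G) K
  have hc0 := nonZeroDivisors.ne_zero hc
  obtain ⟨c', p, hp, hcp⟩ := exists_mul_eq_polyHom (b := b) ht hc0
  obtain ⟨s, t, ht0, hst⟩ := (mem_ratFunctions K hb).1 hx
  have hcK : algebraMap (AddMonoidAlgebra ℚ G) K c ≠ 0 := by
    rwa [Ne, map_eq_zero_iff _ hinj]
  -- clearing denominators, the `n`-th power of `a * c'` is a quotient of polynomials
  have hpow : (a * c') ^ n * polyHom b t = polyHom b (p ^ n * s) := by
    apply hinj
    rw [map_mul, map_pow, map_mul, ← polyFieldHom_apply, ← polyFieldHom_apply, map_mul, ← hst,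
      map_pow, polyFieldHom_apply K b p, ← hcp, map_mul, polyFieldHom_apply]
    simp only [div_pow, mul_pow]
    field_simp
  have hpK : algebraMap (AddMonoidAlgebra ℚ G) K c * algebraMap (AddMonoidAlgebra ℚ G) K c' =
      polyFieldHom K b p := by
    rw [polyFieldHom_apply, ← hcp, map_mul]
  have hp0 : polyFieldHom K b p ≠ 0 := by
    rwa [Ne, map_eq_zero_iff _ (polyFieldHom_injective K hb)]
  have hx' : algebraMap (AddMonoidAlgebra ℚ G) K a / algebraMap (AddMonoidAlgebra ℚ G) K c =
      algebraMap (AddMonoidAlgebra ℚ G) K (a * c') / polyFieldHom K b p := by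
    have hc'0 : algebraMap (AddMonoidAlgebra ℚ G) K c' ≠ 0 := by
      intro h0
      rw [h0, mul_zero] at hpK
      exact hp0 hpK.symm
    rw [← hpK, map_mul, mul_div_mul_right _ _ hc'0]
  have hpmem : polyFieldHom K b p ∈ ratFunctions K hb :=
    (mem_ratFunctions K hb).2 ⟨p, 1, one_ne_zero, by rw [map_one, mul_one]⟩
  rw [hx']
  by_cases ha : (a * c').coeff.support.Nonempty
  · obtain ⟨g₀, hg₀⟩ := ha
    refine ⟨g₀, algebraMap (AddMonoidAlgebra ℚ G) K (AddMonoidAlgebra.single (-g₀) 1 * (a * c')) /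
      polyFieldHom K b p, div_mem (algebraMap_mem_ratFunctions K hb fun g hg => ?_) hpmem, ?_⟩
    · rw [Finsupp.mem_support_iff, AddMonoidAlgebra.coeff_single_mul_apply, one_mul, neg_neg] at hg
      have := sub_mem_closure_of_pow_mul_eq hb hn ht0 hpow (Finsupp.mem_support_iff.2 hg) hg₀
      rwa [add_sub_cancel_left] at this
    · have h1 : fieldMonomial K g₀ *
          algebraMap (AddMonoidAlgebra ℚ G) K (AddMonoidAlgebra.single (-g₀) 1) = 1 := by
        rw [← fieldMonomial.eq_1, ← fieldMonomial_add, add_neg_cancel, fieldMonomial_zero]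
      rw [map_mul _ (AddMonoidAlgebra.single (-g₀) 1), ← mul_div_assoc, ← mul_assoc, h1, one_mul]
  · have h0 : a * c' = 0 := by
      rw [← AddMonoidAlgebra.coeff_eq_zero]
      exact Finsupp.support_eq_empty.1 (Finset.not_nonempty_iff_eq_empty.1 ha)
    exact ⟨0, 0, zero_mem _, by rw [h0, map_zero, zero_div, mul_zero]⟩

/-- Homomorphisms into the multiplicative group of `K` that land in the products of monomials with
rational functions in the monomials of a lattice: modulo constants and monomials, the target embeds
into a free abelian group. -/
theorem exists_addMonoidHom_of_mem_ratFunctions [CharZero K] {Γ : Type*} [AddCommGroup Γ]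
    (θ : Γ → K) (hθ0 : ∀ γ, θ γ ≠ 0) (hθ : ∀ γ δ, θ (γ + δ) = θ γ * θ δ)
    {b : ι → G} (hb : LinearIndependent ℤ b)
    (ht : ∀ g : G, ∃ n : ℕ, n ≠ 0 ∧ n • g ∈ AddSubgroup.closure (Set.range b))
    (hmem : ∀ γ, ∃ (g : G) (y : K), y ∈ ratFunctions K hb ∧ θ γ = fieldMonomial K g * y) :
    ∃ ψ : Γ →+ (MvPolynomial ι ℚ →₀ ℤ),
      ∀ γ, ψ γ = 0 ↔ ∃ (c : ℚ) (g : G), θ γ = (c : K) * fieldMonomial K g := by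
  have hrep : ∀ γ, ∃ (g : G) (p q : MvPolynomial ι ℚ), p ≠ 0 ∧ q ≠ 0 ∧
      θ γ * polyFieldHom K b q = fieldMonomial K g * polyFieldHom K b p := by
    intro γ
    obtain ⟨g, y, hy, h⟩ := hmem γ
    obtain ⟨p, q, hq, hpq⟩ := (mem_ratFunctions K hb).1 hy
    refine ⟨g, p, q, ?_, hq, by rw [h, mul_assoc, hpq]⟩
    rintro rfl
    have hq0 : polyFieldHom K b q ≠ 0 := by
      rwa [Ne, map_eq_zero_iff _ (polyFieldHom_injective K hb)]
    rw [map_zero, mul_eq_zero, or_iff_left hq0] at hpq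
    exact hθ0 γ (by rw [h, hpq, mul_zero])
  choose g p q hp hq hpq using hrep
  -- the value of `nonvariableFactors` at a fraction representing `θ γ` modulo monomials
  have hwd : ∀ (γ : Γ) (k : G) (s t : MvPolynomial ι ℚ), s ≠ 0 → t ≠ 0 →
      θ γ * polyFieldHom K b t = fieldMonomial K k * polyFieldHom K b s →
      nonvariableFactors (p γ) - nonvariableFactors (q γ) =
        nonvariableFactors s - nonvariableFactors t := by
    intro γ k s t hs ht0 h
    have := nonvariableFactors_eq_of_fieldMonomial_mul_eq K hb ht
      (mul_ne_zero (hp γ) ht0) (mul_ne_zero hs (hq γ)) (g := g γ) (h := k) (by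
        rw [map_mul, map_mul, ← mul_assoc, ← mul_assoc, ← hpq, ← h]; ring)
    rw [nonvariableFactors_mul (hp γ) ht0, nonvariableFactors_mul hs (hq γ)] at this
    rw [sub_eq_sub_iff_add_eq_add, this]
  refine ⟨AddMonoidHom.mk' (fun γ => nonvariableFactors (p γ) - nonvariableFactors (q γ)) ?_,
    fun γ => ⟨fun h => ?_, fun h => ?_⟩⟩
  · intro γ δ
    rw [hwd (γ + δ) (g γ + g δ) (p γ * p δ) (q γ * q δ) (mul_ne_zero (hp γ) (hp δ))
      (mul_ne_zero (hq γ) (hq δ)) ?_, nonvariableFactors_mul (hp γ) (hp δ),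
      nonvariableFactors_mul (hq γ) (hq δ)]
    · abel
    · rw [hθ, map_mul, map_mul, fieldMonomial_add]
      calc _ = (θ γ * polyFieldHom K b (q γ)) * (θ δ * polyFieldHom K b (q δ)) := by ring
        _ = _ := by rw [hpq, hpq]; ring
  · obtain ⟨c, u, v, huv⟩ := exists_mul_monomial_eq (hp γ) (hq γ) (sub_eq_zero.1 h)
    refine ⟨c, g γ + (exponentSum b u + -exponentSum b v), ?_⟩
    have hq0 : polyFieldHom K b (q γ) ≠ 0 := by
      rw [Ne, map_eq_zero_iff _ (polyFieldHom_injective K hb)]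
      exact hq γ
    have h1 := congrArg (polyFieldHom K b) huv
    have hC : polyFieldHom K b (MvPolynomial.C c) = (c : K) :=
      map_ratCast ((polyFieldHom K b).comp MvPolynomial.C) c
    rw [map_mul, map_mul, map_mul, polyFieldHom_monomial, polyFieldHom_monomial, hC] at h1
    have h2 : fieldMonomial K (exponentSum b v) * fieldMonomial K (-exponentSum b v) = 1 := by
      rw [← fieldMonomial_add, add_neg_cancel, fieldMonomial_zero]
    refine mul_right_cancel₀ hq0 ?_
    rw [hpq, fieldMonomial_add, fieldMonomial_add]
    calc _ = fieldMonomial K (g γ) * (polyFieldHom K b (p γ) * fieldMonomial K (exponentSum b v)) *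
          fieldMonomial K (-exponentSum b v) := by
          rw [mul_assoc, mul_assoc (polyFieldHom K b (p γ)), h2, mul_one]
      _ = _ := by rw [h1]; ring
  · obtain ⟨c, k, hk⟩ := h
    have hc : c ≠ 0 := by
      rintro rfl
      exact hθ0 γ (by rw [hk, Rat.cast_zero, zero_mul])
    have hC : polyFieldHom K b (MvPolynomial.C c) = (c : K) :=
      map_ratCast ((polyFieldHom K b).comp MvPolynomial.C) c
    change nonvariableFactors (p γ) - nonvariableFactors (q γ) = 0
    rw [hwd γ k (MvPolynomial.C c) 1 (by simpa using hc) one_ne_zero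
      (by rw [hk, hC, map_one, mul_one, mul_comm]), nonvariableFactors_one, sub_zero,
      nonvariableFactors_C hc]

end RationalFunctions

/-! ### Subgroups with a free complement -/

section FreeComplement

theorem isPureAddSubgroup_ker {Γ A : Type} [AddCommGroup Γ] [AddCommGroup A] [IsAddTorsionFree A]
    (ψ : Γ →+ A) : IsPureAddSubgroup ψ.ker := by
  intro k g hk h
  rw [AddMonoidHom.mem_ker, map_zsmul] at h
  rw [AddMonoidHom.mem_ker]
  exact (smul_eq_zero.1 h).resolve_left hk

/-- The kernel of a homomorphism from a group of finite rank into a free abelian group is a direct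
summand, and the complement is finitely generated and free. -/
theorem exists_hasFreeComplement_ker {Γ I : Type} [AddCommGroup Γ] (ψ : Γ →+ (I →₀ ℤ)) {s : Set Γ}
    (hs : s.Finite) (ht : ∀ γ : Γ, ∃ n : ℕ, n ≠ 0 ∧ n • γ ∈ AddSubgroup.closure s) :
    ∃ k, HasFreeComplement ψ.ker k := by
  classical
  let f : Γ →ₗ[ℤ] (I →₀ ℤ) := ψ.toIntLinearMap
  have hf : ∀ γ, f γ = ψ γ := fun _ => rfl
  -- all values are supported on the union of the supports of the values on `s`
  let t : Set I := ⋃ γ ∈ s, ((ψ γ).support : Set I)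
  have htfin : t.Finite := hs.biUnion fun γ _ => (ψ γ).support.finite_toSet
  have hcl : ∀ γ ∈ AddSubgroup.closure s, ψ γ ∈ Finsupp.supported ℤ ℤ t := by
    intro γ hγ
    induction hγ using AddSubgroup.closure_induction with
    | mem x hx =>
      rw [Finsupp.mem_supported]
      exact Set.subset_biUnion_of_mem (u := fun γ => ((ψ γ).support : Set I)) hx
    | zero => rw [map_zero]; exact zero_mem _
    | add x y _ _ hx hy => rw [map_add]; exact add_mem hx hy
    | neg x _ hx => rw [map_neg]; exact neg_mem hx
  have hsup : LinearMap.range f ≤ Finsupp.supported ℤ ℤ t := by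
    rintro _ ⟨γ, rfl⟩
    obtain ⟨n, hn, h⟩ := ht γ
    have h1 := hcl _ h
    rw [map_nsmul, Finsupp.mem_supported] at h1
    rw [Finsupp.mem_supported, hf]
    intro i hi
    refine h1 ?_
    have hi' : ψ γ i ≠ 0 := by simpa using hi
    simpa using ⟨hn, hi'⟩
  have : Finite t := htfin
  have hfinsup : Module.Finite ℤ (Finsupp.supported ℤ ℤ t) :=
    Module.Finite.equiv (Finsupp.supportedEquivFinsupp t).symm
  have hfin : Module.Finite ℤ (LinearMap.range f) :=
    Module.Finite.of_injective (Submodule.inclusion hsup) (Submodule.inclusion_injective hsup)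
  have hfree : Module.Free ℤ (LinearMap.range f) := Module.free_of_finite_type_torsion_free'
  obtain ⟨σ, hσ⟩ := Module.projective_lifting_property f.rangeRestrict LinearMap.id
    f.surjective_rangeRestrict
  have hσ' : ∀ y, f (σ y) = y := fun y => congrArg Subtype.val (LinearMap.congr_fun hσ y)
  have hσinj : Function.Injective σ := fun x y h => Subtype.ext (by rw [← hσ' x, h, hσ' y])
  refine ⟨Module.finrank ℤ (LinearMap.range f), σ.toAddMonoidHom.range, ?_, ⟨?_⟩⟩
  · rw [isCompl_iff, AddSubgroup.disjoint_def, codisjoint_iff, eq_top_iff]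
    refine ⟨?_, fun x _ => ?_⟩
    · rintro x hx ⟨y, rfl⟩
      have h0 : f (σ y) = 0 := hx
      have : y = 0 := Subtype.ext (by rw [← hσ' y, h0]; rfl)
      rw [this]
      exact map_zero σ
    · refine AddSubgroup.mem_sup.2 ⟨x - σ (f.rangeRestrict x), ?_, σ (f.rangeRestrict x),
        ⟨_, rfl⟩, sub_add_cancel _ _⟩
      change f (x - σ (f.rangeRestrict x)) = 0
      rw [map_sub, hσ', sub_eq_zero]
      rfl
  · exact (AddMonoidHom.ofInjective (f := σ.toAddMonoidHom) hσinj).symm.trans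
      (Module.finBasis ℤ (LinearMap.range f)).equivFun.toAddEquiv

variable {G G' : Type} [AddCommGroup G] [AddCommGroup G']

theorem rank_add_of_hasFreeComplement {H : AddSubgroup G} {k : ℕ} (h : HasFreeComplement H k) :
    Module.rank ℤ G = k + Module.rank ℤ H := by
  obtain ⟨K, hc, ⟨e⟩⟩ := h
  have hc' : IsCompl (AddSubgroup.toIntSubmodule H) (AddSubgroup.toIntSubmodule K) :=
    (AddSubgroup.toIntSubmodule : AddSubgroup G ≃o Submodule ℤ G).isCompl_iff.1 hc
  have e1 : (G ⧸ AddSubgroup.toIntSubmodule H) ≃ₗ[ℤ] (Fin k → ℤ) :=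
    (Submodule.quotientEquivOfIsCompl _ _ hc').trans e.toIntLinearEquiv
  rw [← rank_quotient_add_rank_of_isDomain (AddSubgroup.toIntSubmodule H), e1.rank_eq, rank_fin_fun]
  rfl

theorem eq_of_hasFreeComplement {r k k' : ℕ} (hG : Module.rank ℤ G = r)
    (hG' : Module.rank ℤ G' = r) {H : AddSubgroup G} {H' : AddSubgroup G'} (e : H ≃+ H')
    (h : HasFreeComplement H k) (h' : HasFreeComplement H' k') : k = k' := by
  have h1 := rank_add_of_hasFreeComplement h
  have h2 := rank_add_of_hasFreeComplement h'
  rw [hG, e.toIntLinearEquiv.rank_eq] at h1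
  rw [hG'] at h2
  have hlt : Module.rank ℤ H' < Cardinal.aleph0 :=
    lt_of_le_of_lt (h1 ▸ le_add_self) (Cardinal.natCast_lt_aleph0 (n := r))
  obtain ⟨m, hm⟩ := Cardinal.lt_aleph0.1 hlt
  rw [hm] at h1 h2
  have h3 : r = k + m := by exact_mod_cast h1
  have h4 : r = k' + m := by exact_mod_cast h2
  omega

theorem nonempty_addEquiv_of_hasFreeComplement {k : ℕ} {H : AddSubgroup G} {H' : AddSubgroup G'}
    (e : H ≃+ H') (h : HasFreeComplement H k) (h' : HasFreeComplement H' k) :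
    Nonempty (G ≃+ G') := by
  obtain ⟨K, hc, ⟨f⟩⟩ := h
  obtain ⟨K', hc', ⟨f'⟩⟩ := h'
  have hi := (AddSubgroup.toIntSubmodule : AddSubgroup G ≃o Submodule ℤ G).isCompl_iff.1 hc
  have hi' := (AddSubgroup.toIntSubmodule : AddSubgroup G' ≃o Submodule ℤ G').isCompl_iff.1 hc'
  exact ⟨((Submodule.prodEquivOfIsCompl _ _ hi).symm.toAddEquiv.trans
    (e.prodCongr (f.trans f'.symm))).trans (Submodule.prodEquivOfIsCompl _ _ hi').toAddEquiv⟩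

end FreeComplement

/-! ### Lattices in groups of finite rank -/

section Lattices

/-- A maximal linearly independent family spans a lattice with torsion quotient. -/
theorem exists_linearIndependent_of_rank_eq {G : Type} [AddCommGroup G] {r : ℕ}
    (h : Module.rank ℤ G = r) :
    ∃ b : Fin r → G, LinearIndependent ℤ b ∧
      ∀ g : G, ∃ n : ℕ, n ≠ 0 ∧ n • g ∈ AddSubgroup.closure (Set.range b) := by
  obtain ⟨s, hs, hli⟩ := exists_set_linearIndependent_of_isDomain ℤ G
  rw [h] at hs
  obtain ⟨e⟩ : Nonempty (Fin r ≃ s) := by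
    rw [← Cardinal.eq, hs, Cardinal.mk_fin]
  have hli' : LinearIndependent ℤ (fun i => (e i : G)) :=
    LinearIndependent.comp (v := fun x : s => (x : G)) hli e e.injective
  refine ⟨fun i => e i, hli', fun g => ?_⟩
  have h1 := rank_quotient_add_rank_of_isDomain
    (Submodule.span ℤ (Set.range fun i => (e i : G)))
  rw [rank_span hli', Cardinal.mk_range_eq _ hli'.injective, Cardinal.mk_fin, h] at h1
  have h2 : Module.rank ℤ (G ⧸ Submodule.span ℤ (Set.range fun i => (e i : G))) = 0 := by
    refine (Cardinal.add_eq_right_iff.1 h1).resolve_left fun hω => ?_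
    exact absurd ((le_max_left _ _).trans hω) (not_le.2 (Cardinal.natCast_lt_aleph0 (n := r)))
  obtain ⟨n, hn, hng⟩ := rank_eq_zero_iff.1 h2 (Submodule.Quotient.mk g)
  rw [← Submodule.Quotient.mk_smul, Submodule.Quotient.mk_eq_zero] at hng
  have hmem : n • g ∈ AddSubgroup.closure (Set.range fun i => (e i : G)) := by
    rw [← Submodule.span_int_eq_addSubgroupClosure]
    exact hng
  refine ⟨n.natAbs, Int.natAbs_ne_zero.2 hn, ?_⟩
  rcases Int.natAbs_eq n with h | h
  · rw [h, natCast_zsmul] at hmem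
    exact hmem
  · rw [h, neg_smul, natCast_zsmul] at hmem
    exact neg_mem_iff.1 hmem

/-- Finitely generated subgroups of torsion-free groups are free. -/
theorem exists_linearIndependent_closure_eq {G : Type*} [AddCommGroup G] [IsAddTorsionFree G]
    {s : Set G} (hs : s.Finite) :
    ∃ (n : ℕ) (b : Fin n → G), LinearIndependent ℤ b ∧
      AddSubgroup.closure (Set.range b) = AddSubgroup.closure s := by
  let L := Submodule.span ℤ s
  have : Module.Finite ℤ L := Module.Finite.span_of_finite ℤ hs
  have : Module.Free ℤ L := Module.free_of_finite_type_torsion_free'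
  let b := Module.finBasis ℤ L
  refine ⟨_, fun i => (b i : G), b.linearIndependent.map' L.subtype L.ker_subtype, ?_⟩
  have h1 : Submodule.span ℤ (Set.range fun i => (b i : G)) = L := by
    have : (Set.range fun i => (b i : G)) = L.subtype '' Set.range b := by
      rw [← Set.range_comp]; rfl
    rw [this, Submodule.span_image, b.span_eq, Submodule.map_top, L.range_subtype]
  rw [← Submodule.span_int_eq_addSubgroupClosure, h1, Submodule.span_int_eq_addSubgroupClosure]

end Lattices

/-! ### Isomorphisms between fields of fractions of group algebras -/

section Isomorphisms

variable {G G' : Type} [AddCommGroup G] [AddCommGroup G']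
  {K K' : Type} [Field K] [Field K'] [CharZero K']
  [Algebra (AddMonoidAlgebra ℚ G) K] [Algebra (AddMonoidAlgebra ℚ G') K']

/-- The elements `g` for which `φ` maps the monomial of `g` to a rational multiple of a monomial. -/
def monomialSubgroup (φ : K ≃+* K') : AddSubgroup G where
  carrier := {g | ∃ (c : ℚ) (g' : G'), φ (fieldMonomial K g) = (c : K') * fieldMonomial K' g'}
  zero_mem' := ⟨1, 0, by simp⟩
  add_mem' := by
    rintro g h ⟨c, g', hg⟩ ⟨d, h', hh⟩
    refine ⟨c * d, g' + h', ?_⟩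
    rw [fieldMonomial_add, fieldMonomial_add, map_mul, hg, hh, Rat.cast_mul]
    ring
  neg_mem' := by
    rintro g ⟨c, g', hg⟩
    refine ⟨c⁻¹, -g', ?_⟩
    have h1 : fieldMonomial K (-g) * fieldMonomial K g = 1 := by
      rw [← fieldMonomial_add, neg_add_cancel, fieldMonomial_zero]
    have h2 : fieldMonomial K' g' * fieldMonomial K' (-g') = 1 := by
      rw [← fieldMonomial_add, add_neg_cancel, fieldMonomial_zero]
    have hne : φ (fieldMonomial K g) ≠ 0 := by
      rw [Ne, map_eq_zero_iff _ φ.injective]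
      exact right_ne_zero_of_mul_eq_one h1
    have hc : (c : K') ≠ 0 := by
      intro h0
      rw [h0, zero_mul] at hg
      exact hne hg
    refine mul_right_cancel₀ hne ?_
    rw [← map_mul, h1, map_one, hg, Rat.cast_inv]
    calc (1 : K') = (c : K')⁻¹ * c * (fieldMonomial K' g' * fieldMonomial K' (-g')) := by
          rw [h2, inv_mul_cancel₀ hc, one_mul]
      _ = _ := by ring

theorem mem_monomialSubgroup {φ : K ≃+* K'} {g : G} :
    g ∈ monomialSubgroup (G' := G') φ ↔
      ∃ (c : ℚ) (g' : G'), φ (fieldMonomial K g) = (c : K') * fieldMonomial K' g' := Iff.rfl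

variable [IsFractionRing (AddMonoidAlgebra ℚ G) K]

theorem symm_fieldMonomial_eq {φ : K ≃+* K'} {g : G} {g' : G'} {c : ℚ}
    (h : φ (fieldMonomial K g) = (c : K') * fieldMonomial K' g') :
    φ.symm (fieldMonomial K' g') = ((c⁻¹ : ℚ) : K) * fieldMonomial K g := by
  have hc : (c : K') ≠ 0 := by
    intro h0
    rw [h0, zero_mul, map_eq_zero_iff _ φ.injective] at h
    exact fieldMonomial_ne_zero K g h
  rw [RingEquiv.symm_apply_eq, map_mul, h, map_ratCast, Rat.cast_inv, inv_mul_cancel_left₀ hc]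

variable [IsFractionRing (AddMonoidAlgebra ℚ G') K']

theorem eq_of_map_fieldMonomial {φ : K ≃+* K'} {g : G} {g' h' : G'} {c d : ℚ}
    (h1 : φ (fieldMonomial K g) = (c : K') * fieldMonomial K' g')
    (h2 : φ (fieldMonomial K g) = (d : K') * fieldMonomial K' h') : g' = h' := by
  have h3 := symm_fieldMonomial_eq h1
  have h4 : fieldMonomial K' g' = ((c⁻¹ * d : ℚ) : K') * fieldMonomial K' h' := by
    rw [← φ.apply_symm_apply (fieldMonomial K' g'), h3, map_mul, map_ratCast, h2, Rat.cast_mul,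
      mul_assoc]
  exact eq_of_fieldMonomial_eq_mul K' h4

/-- The matching of monomials by `φ` is an isomorphism of groups. -/
theorem exists_monomialSubgroup_addEquiv [CharZero K] (φ : K ≃+* K') :
    ∃ e : monomialSubgroup (G := G) (G' := G') φ ≃+ monomialSubgroup (G := G') (G' := G) φ.symm,
      ∀ h : monomialSubgroup (G := G) (G' := G') φ,
        ∃ c : ℚ, φ (fieldMonomial K (h : G)) = (c : K') * fieldMonomial K' (e h : G') := by
  have hex : ∀ h : monomialSubgroup (G := G) (G' := G') φ, ∃ (g' : G') (c : ℚ),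
      φ (fieldMonomial K (h : G)) = (c : K') * fieldMonomial K' g' := by
    rintro ⟨g, c, g', h⟩
    exact ⟨g', c, h⟩
  choose f c hf using hex
  have hmem : ∀ h, f h ∈ monomialSubgroup (G := G') (G' := G) φ.symm := fun h =>
    ⟨_, _, symm_fieldMonomial_eq (hf h)⟩
  let F : monomialSubgroup (G := G) (G' := G') φ →+
      monomialSubgroup (G := G') (G' := G) φ.symm :=
    AddMonoidHom.mk' (fun h => ⟨f h, hmem h⟩) fun g h => by
      refine Subtype.ext (eq_of_map_fieldMonomial (d := c g * c h) (hf (g + h)) ?_)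
      change φ (fieldMonomial K ((g : G) + h)) = _ * fieldMonomial K' (f g + f h)
      rw [fieldMonomial_add, map_mul, hf, hf, fieldMonomial_add, Rat.cast_mul]
      ring
  refine ⟨AddEquiv.ofBijective F ⟨fun g h hgh => ?_, fun g' => ?_⟩, fun h =>
    ⟨c h, hf h⟩⟩
  · have h1 : f g = f h := congrArg Subtype.val hgh
    have h2 := symm_fieldMonomial_eq (hf g)
    rw [h1] at h2
    exact Subtype.ext (eq_of_map_fieldMonomial h2 (symm_fieldMonomial_eq (hf h)))
  · obtain ⟨g', d, g, h⟩ := g'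
    have h1 := symm_fieldMonomial_eq h
    rw [RingEquiv.symm_symm] at h1
    exact ⟨⟨g, _, _, h1⟩, Subtype.ext (eq_of_map_fieldMonomial (hf ⟨g, _, _, h1⟩) h1)⟩

variable [IsAddTorsionFree G']

/-- The images of the monomials of a group of finite rank have, modulo constants and monomials,
divisors in a free abelian group. -/
theorem exists_ker_eq_monomialSubgroup {r r' : ℕ} (hG : Module.rank ℤ G = r)
    (hG' : Module.rank ℤ G' = r') (φ : K ≃+* K') :
    ∃ (I : Type) (ψ : G →+ (I →₀ ℤ)), ψ.ker = monomialSubgroup (G' := G') φ := by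
  classical
  obtain ⟨a, -, hat⟩ := exists_linearIndependent_of_rank_eq hG
  obtain ⟨b₀, -, hbt⟩ := exists_linearIndependent_of_rank_eq hG'
  have hfrac : ∀ i, ∃ x y : AddMonoidAlgebra ℚ G',
      φ (fieldMonomial K (a i)) = algebraMap _ K' x / algebraMap _ K' y := by
    intro i
    obtain ⟨x, y, -, h⟩ := IsFractionRing.div_surjective (A := AddMonoidAlgebra ℚ G')
      (φ (fieldMonomial K (a i)))
    exact ⟨x, y, h.symm⟩
  choose x y hxy using hfrac
  -- a lattice that contains the supports of the images of finitely many monomials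
  let s : Set G' := Set.range b₀ ∪ ⋃ i, ((x i).coeff.support ∪ (y i).coeff.support : Set G')
  have hsfin : s.Finite := (Set.finite_range b₀).union (Set.finite_iUnion fun i =>
    (x i).coeff.support.finite_toSet.union (y i).coeff.support.finite_toSet)
  obtain ⟨n, b, hb, hbs⟩ := exists_linearIndependent_closure_eq hsfin
  have hsub : ∀ g ∈ s, g ∈ AddSubgroup.closure (Set.range b) := fun g hg => by
    rw [hbs]
    exact AddSubgroup.subset_closure hg
  have ht : ∀ g : G', ∃ n : ℕ, n ≠ 0 ∧ n • g ∈ AddSubgroup.closure (Set.range b) := by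
    intro g
    obtain ⟨n, hn, h⟩ := hbt g
    refine ⟨n, hn, ?_⟩
    rw [hbs]
    exact AddSubgroup.closure_mono Set.subset_union_left h
  have hgen : ∀ i, φ (fieldMonomial K (a i)) ∈ ratFunctions K' hb := by
    intro i
    rw [hxy]
    refine div_mem (algebraMap_mem_ratFunctions K' hb fun g hg => hsub g ?_)
      (algebraMap_mem_ratFunctions K' hb fun g hg => hsub g ?_)
    · exact Or.inr (Set.mem_iUnion.2 ⟨i, Or.inl hg⟩)
    · exact Or.inr (Set.mem_iUnion.2 ⟨i, Or.inr hg⟩)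
  have hcl : ∀ g ∈ AddSubgroup.closure (Set.range a),
      φ (fieldMonomial K g) ∈ ratFunctions K' hb := by
    intro g hg
    induction hg using AddSubgroup.closure_induction with
    | mem g hg => obtain ⟨i, rfl⟩ := hg; exact hgen i
    | zero => rw [fieldMonomial_zero, map_one]; exact one_mem _
    | add g h _ _ hg hh => rw [fieldMonomial_add, map_mul]; exact mul_mem hg hh
    | neg g _ hg =>
      have h1 : fieldMonomial K (-g) = (fieldMonomial K g)⁻¹ := by
        refine eq_inv_of_mul_eq_one_left ?_
        rw [← fieldMonomial_add, neg_add_cancel, fieldMonomial_zero]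
      rw [h1, map_inv₀]
      exact inv_mem hg
  obtain ⟨ψ, hψ⟩ := exists_addMonoidHom_of_mem_ratFunctions K' (fun g : G => φ (fieldMonomial K g))
    (fun g => by rw [Ne, map_eq_zero_iff _ φ.injective]; exact fieldMonomial_ne_zero K g)
    (fun g h => by rw [fieldMonomial_add, map_mul]) hb ht (fun g => by
      obtain ⟨n, hn, h⟩ := hat g
      refine exists_eq_fieldMonomial_mul_of_pow_mem K' hb ht (Nat.pos_of_ne_zero hn) ?_
      rw [← map_pow, ← fieldMonomial_nsmul]
      exact hcl _ h)
  exact ⟨_, ψ, AddSubgroup.ext fun g => by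
    rw [AddMonoidHom.mem_ker, hψ, mem_monomialSubgroup]⟩

theorem monomialSubgroup_isPure_and_hasFreeComplement {r r' : ℕ} (hG : Module.rank ℤ G = r)
    (hG' : Module.rank ℤ G' = r') (φ : K ≃+* K') :
    IsPureAddSubgroup (monomialSubgroup (G := G) (G' := G') φ) ∧
      ∃ k, HasFreeComplement (monomialSubgroup (G := G) (G' := G') φ) k := by
  obtain ⟨I, ψ, hψ⟩ := exists_ker_eq_monomialSubgroup (G := G) (G' := G') hG hG' φ
  obtain ⟨a, -, hat⟩ := exists_linearIndependent_of_rank_eq hG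
  rw [← hψ]
  exact ⟨isPureAddSubgroup_ker ψ, exists_hasFreeComplement_ker ψ (Set.finite_range a) hat⟩

end Isomorphisms

/-! ### The transcendence degree -/

section TranscendenceDegree

/-- The monomials of a maximal linearly independent family of `G` are a transcendence basis. -/
theorem trdeg_eq_of_rank_eq {G : Type} [AddCommGroup G] [IsAddTorsionFree G] {r : ℕ}
    (h : Module.rank ℤ G = r) (K : Type) [Field K] [Algebra (AddMonoidAlgebra ℚ G) K]
    [IsFractionRing (AddMonoidAlgebra ℚ G) K] [Algebra ℚ K] : Algebra.trdeg ℚ K = r := by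
  obtain ⟨b, hb, ht⟩ := exists_linearIndependent_of_rank_eq h
  have haeval : ∀ p : MvPolynomial (Fin r) ℚ,
      MvPolynomial.aeval (fun i => fieldMonomial K (b i)) p = polyFieldHom K b p := by
    intro p
    have : (MvPolynomial.aeval (R := ℚ) (fun i => fieldMonomial K (b i))).toRingHom =
        polyFieldHom K b := by
      refine MvPolynomial.ringHom_ext' (Subsingleton.elim _ _) fun i => ?_
      simp [polyFieldHom_apply, fieldMonomial]
    exact RingHom.congr_fun this p
  have hind : AlgebraicIndependent ℚ (fun i => fieldMonomial K (b i)) := by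
    intro p q hpq
    rw [haeval, haeval] at hpq
    exact polyFieldHom_injective K hb hpq
  let A := Algebra.adjoin ℚ (Set.range fun i => fieldMonomial K (b i))
  have hA : ∀ p, polyFieldHom K b p ∈ A := fun p => by
    rw [← haeval]
    exact (Algebra.adjoin_range_eq_range_aeval ℚ (fun i => fieldMonomial K (b i))).ge ⟨p, rfl⟩
  have halg : Algebra.IsAlgebraic A K := by
    have hlat : ∀ l ∈ AddSubgroup.closure (Set.range b), IsAlgebraic A (fieldMonomial K l) := by
      intro l hl
      obtain ⟨p, q, hq, hpq⟩ := (mem_ratFunctions K hb).1 (fieldMonomial_mem_ratFunctions K hb hl)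
      have hq0 : polyFieldHom K b q ≠ 0 := by
        rwa [Ne, map_eq_zero_iff _ (polyFieldHom_injective K hb)]
      rw [eq_div_of_mul_eq hq0 hpq, div_eq_mul_inv]
      exact (isAlgebraic_algebraMap (⟨_, hA p⟩ : A)).mul
        (isAlgebraic_algebraMap (⟨_, hA q⟩ : A)).inv
    have hmon : ∀ g : G, IsAlgebraic A (fieldMonomial K g) := by
      intro g
      obtain ⟨n, hn, hg⟩ := ht g
      refine IsAlgebraic.of_pow (Nat.pos_of_ne_zero hn) ?_
      rw [← fieldMonomial_nsmul]
      exact hlat _ hg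
    have hpol : ∀ a : AddMonoidAlgebra ℚ G, IsAlgebraic A (algebraMap _ K a) := by
      intro a
      have := charZero_of_algebra_addMonoidAlgebra G K
      induction a using AddMonoidAlgebra.induction_linear with
      | zero => rw [map_zero]; exact isAlgebraic_zero
      | add x y hx hy => rw [map_add]; exact hx.add hy
      | single g q =>
        rw [algebraMap_single, ← map_ratCast (algebraMap ℚ K), Rat.cast_id]
        exact (isAlgebraic_algebraMap (algebraMap ℚ A q)).mul (hmon g)
    refine ⟨fun x => ?_⟩
    obtain ⟨a, c, -, rfl⟩ := IsFractionRing.div_surjective (A := AddMonoidAlgebra ℚ G) x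
    rw [div_eq_mul_inv]
    exact (hpol a).mul (hpol c).inv
  have := (hind.isTranscendenceBasis_iff_isAlgebraic).2 halg
  rw [← this.cardinalMk_eq_trdeg, Cardinal.mk_fin]

end TranscendenceDegree

/-! ### Uniform computability relative to a family of oracles -/

section UniformComputability

open Encodable

theorem IsTuringFunctional.of_eq {P Q : (ℕ → ℕ) → ℕ →. ℕ} (hP : IsTuringFunctional P)
    (h : ∀ A n, P A n = Q A n) : IsTuringFunctional Q :=
  (funext₂ h : P = Q) ▸ hP

theorem IsTuringFunctional.of_natPrimrec {f : ℕ → ℕ} (hf : Nat.Primrec f) :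
    IsTuringFunctional fun _ n => Part.some (f n) := by
  induction hf with
  | zero => exact .zero
  | succ => exact .succ
  | left => exact .left
  | right => exact .right
  | pair _ _ ih₁ ih₂ =>
    exact (IsTuringFunctional.pair ih₁ ih₂).of_eq fun A n => by simp [Seq.seq]
  | comp _ _ ih₁ ih₂ =>
    exact (IsTuringFunctional.comp ih₁ ih₂).of_eq fun A n => by simp
  | @prec f g _ _ ih₁ ih₂ =>
    refine (IsTuringFunctional.prec ih₁ ih₂).of_eq fun A n => ?_
    simp only [Nat.unpaired]
    induction n.unpair.2 with
    | zero => rfl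
    | succ y ih =>
      exact (congrArg (fun t : Part ℕ => t >>= fun i =>
        Part.some (g (Nat.pair n.unpair.1 (Nat.pair y i)))) ih).trans (Part.bind_some _ _)

/-- The family of functions `F x` is computed, uniformly in `x`, by a single Turing functional with
the oracle `o x`. -/
def UniformlyComputable {X α β : Type*} [Primcodable α] [Primcodable β] (o : X → ℕ → ℕ)
    (F : X → α → β) : Prop :=
  ∃ P, IsTuringFunctional P ∧ ∀ x a, P (o x) (encode a) = Part.some (encode (F x a))

/-- Uniform computability of a family of functions of two arguments. -/
def UniformlyComputable₂ {X α β γ : Type*} [Primcodable α] [Primcodable β] [Primcodable γ]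
    (o : X → ℕ → ℕ) (F : X → α → β → γ) : Prop :=
  UniformlyComputable o fun x (p : α × β) => F x p.1 p.2

variable {X α β γ δ : Type*} [Primcodable α] [Primcodable β] [Primcodable γ] [Primcodable δ]
  {o : X → ℕ → ℕ}

theorem Primrec.uniformlyComputable {f : α → β} (hf : Primrec f) :
    UniformlyComputable o fun _ => f := by
  refine ⟨_, .of_natPrimrec (Nat.Primrec.pred.comp hf), fun x a => ?_⟩
  simp

theorem Primrec₂.uniformlyComputable₂ {f : α → β → γ} (hf : Primrec₂ f) :
    UniformlyComputable₂ o fun _ => f :=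
  Primrec.uniformlyComputable hf

namespace UniformlyComputable

theorem comp {F : X → β → γ} {f : X → α → β} (hF : UniformlyComputable o F)
    (hf : UniformlyComputable o f) : UniformlyComputable o fun x a => F x (f x a) := by
  obtain ⟨P, hP, h⟩ := hF
  obtain ⟨Q, hQ, h'⟩ := hf
  exact ⟨_, .comp hP hQ, fun x a => by
    rw [h', ← h x (f x a)]
    exact Part.bind_some _ _⟩

theorem pair {F : X → α → β} {F' : X → α → γ} (hF : UniformlyComputable o F)
    (hF' : UniformlyComputable o F') : UniformlyComputable o fun x a => (F x a, F' x a) := by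
  obtain ⟨P, hP, h⟩ := hF
  obtain ⟨Q, hQ, h'⟩ := hF'
  exact ⟨_, .pair hP hQ, fun x a => by simp [h, h', Seq.seq]⟩

theorem query : UniformlyComputable o fun x (n : ℕ) => o x n :=
  ⟨_, .query, fun _ _ => rfl⟩

theorem nat_rec {F : X → α → β} {S : X → α × (ℕ × β) → β} {n : X → α → ℕ}
    (hF : UniformlyComputable o F) (hS : UniformlyComputable o S) (hn : UniformlyComputable o n) :
    UniformlyComputable o fun x a =>
      Nat.rec (motive := fun _ => β) (F x a) (fun y b => S x (a, (y, b))) (n x a) := by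
  obtain ⟨P, hP, h⟩ := hF
  obtain ⟨Q, hQ, h'⟩ := hS
  have key : UniformlyComputable o fun x (p : α × ℕ) =>
      Nat.rec (motive := fun _ => β) (F x p.1) (fun y b => S x (p.1, (y, b))) p.2 := by
    refine ⟨_, .prec hP hQ, ?_⟩
    rintro x ⟨a, k⟩
    simp only [encode_prod_val, encode_nat, Nat.unpair_pair]
    induction k with
    | zero => exact h x a
    | succ y ih =>
      have := h' x (a, (y, Nat.rec (motive := fun _ => β) (F x a) (fun y b => S x (a, (y, b))) y))
      simp only [encode_prod_val, encode_nat] at this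
      simp only [ih]
      simpa using this
  exact key.comp ((Primrec.id.uniformlyComputable).pair hn)

/-- Unbounded search, where it succeeds for all members of the family. -/
theorem rfind {p : X → α × ℕ → Bool} {n : X → α → ℕ} (hp : UniformlyComputable o p)
    (hn : ∀ x a, p x (a, n x a) = true ∧ ∀ m < n x a, p x (a, m) = false) :
    UniformlyComputable o n := by
  have hp' : UniformlyComputable o fun x a => bif p x a then 0 else 1 :=
    (Primrec.cond Primrec.id (Primrec.const 0) (Primrec.const 1)).uniformlyComputable.comp hp
  obtain ⟨P, hP, h⟩ := hp'
  refine ⟨_, .rfind hP, fun x a => ?_⟩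
  have h1 : ∀ k, P (o x) (Nat.pair (encode a) k) =
      Part.some (bif p x (a, k) then 0 else 1) := fun k => by
    simpa using h x (a, k)
  have h2 : ∀ k, (fun m => decide (m = 0)) <$> P (o x) (Nat.pair (encode a) k) =
      Part.some (p x (a, k)) := fun k => by
    rw [h1, Part.map_eq_map, Part.map_some]
    cases p x (a, k) <;> rfl
  refine Part.eq_some_iff.2 (Nat.mem_rfind.2 ⟨?_, fun {m} hm => ?_⟩)
  · exact (h2 _).symm ▸ (Part.mem_some_iff.2 (hn x a).1.symm)
  · exact (h2 m).symm ▸ (Part.mem_some_iff.2 ((hn x a).2 m hm).symm)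

theorem comp₂ {F : X → β → γ → δ} {f : X → α → β} {g : X → α → γ}
    (hF : UniformlyComputable₂ o F) (hf : UniformlyComputable o f)
    (hg : UniformlyComputable o g) : UniformlyComputable o fun x a => F x (f x a) (g x a) :=
  comp (F := fun x (p : β × γ) => F x p.1 p.2) hF (hf.pair hg)

theorem of_eq {F F' : X → α → β} (hF : UniformlyComputable o F) (h : ∀ x a, F x a = F' x a) :
    UniformlyComputable o F' :=
  (funext₂ h : F = F') ▸ hF

theorem fst {F : X → α → β × γ} (hF : UniformlyComputable o F) :
    UniformlyComputable o fun x a => (F x a).1 :=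
  Primrec.fst.uniformlyComputable.comp hF

theorem snd {F : X → α → β × γ} (hF : UniformlyComputable o F) :
    UniformlyComputable o fun x a => (F x a).2 :=
  Primrec.snd.uniformlyComputable.comp hF

theorem id : UniformlyComputable o fun _ (a : α) => a :=
  Primrec.id.uniformlyComputable

theorem bcond {p : X → α → Bool} {F F' : X → α → β} (hp : UniformlyComputable o p)
    (hF : UniformlyComputable o F) (hF' : UniformlyComputable o F') :
    UniformlyComputable o fun x a => bif p x a then F x a else F' x a :=
  ((Primrec.cond Primrec.fst (Primrec.fst.comp Primrec.snd)
    (Primrec.snd.comp Primrec.snd)).uniformlyComputable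
      (f := fun q : Bool × β × β => bif q.1 then q.2.1 else q.2.2)).comp (hp.pair (hF.pair hF'))

theorem count {p : X → α → ℕ → Bool} {n : X → α → ℕ} (hp : UniformlyComputable₂ o p)
    (hn : UniformlyComputable o n) :
    UniformlyComputable o fun x a => Nat.count (fun m => p x a m = true) (n x a) := by
  have hS : UniformlyComputable o fun x (q : α × (ℕ × ℕ)) =>
      bif p x q.1 q.2.1 then q.2.2 + 1 else q.2.2 :=
    bcond (comp₂ hp id.fst id.snd.fst) (Primrec.succ.uniformlyComputable.comp id.snd.snd)
      id.snd.snd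
  refine (nat_rec (Primrec.const 0).uniformlyComputable hS hn).of_eq fun x a => ?_
  induction n x a with
  | zero => simp
  | succ k ih =>
    simp only [ih, Nat.count_succ]
    cases p x a k <;> simp

theorem list_map [Inhabited β] {l : X → α → List β} {F : X → α → β → γ}
    (hl : UniformlyComputable o l) (hF : UniformlyComputable₂ o F) :
    UniformlyComputable o fun x a => (l x a).map (F x a) := by
  have hS : UniformlyComputable o fun x (q : α × (ℕ × List γ)) =>
      q.2.2 ++ [F x q.1 ((l x q.1).getI q.2.1)] :=
    comp₂ (F := fun _ (l : List γ) c => l ++ [c])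
      Primrec.list_concat.uniformlyComputable₂ id.snd.snd
      (comp₂ hF id.fst (comp₂ Primrec.list_getI.uniformlyComputable₂ (hl.comp id.fst) id.snd.fst))
  refine (nat_rec (Primrec.const []).uniformlyComputable hS
    (Primrec.list_length.uniformlyComputable.comp hl)).of_eq fun x a => ?_
  have key : ∀ k ≤ (l x a).length, Nat.rec (motive := fun _ => List γ) []
      (fun y b => b ++ [F x a ((l x a).getI y)]) k = ((l x a).take k).map (F x a) := by
    intro k
    induction k with
    | zero => simp
    | succ k ih =>
      intro hk
      refine (congrArg (fun t => t ++ [F x a ((l x a).getI k)])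
        (ih (Nat.le_of_succ_le hk))).trans ?_
      rw [List.take_add_one, List.getElem?_eq_getElem hk,
        List.getI_eq_getElem _ hk, List.map_append]
      rfl
  simpa using key _ le_rfl

theorem list_flatMap [Inhabited β] {l : X → α → List β} {F : X → α → β → List γ}
    (hl : UniformlyComputable o l) (hF : UniformlyComputable₂ o F) :
    UniformlyComputable o fun x a => (l x a).flatMap (F x a) := by
  simp only [List.flatMap_def]
  exact Primrec.list_flatten.uniformlyComputable.comp (list_map hl hF)

end UniformlyComputable

end UniformComputability

/-! ### Codes for rational functions -/

section Codes

/-- A pair of lists of elements of a group with universe `ℕ` codes the difference of the sums of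
their monomials, an element of the integral group ring. -/
abbrev PolyCode : Type := List ℕ × List ℕ

/-- A code for a fraction: numerator and denominator. -/
abbrev FracCode : Type := PolyCode × PolyCode

namespace PolyCode

/-- All sums of an entry of `l` and an entry of `m`, for the addition `add`. -/
def listMul (add : ℕ → ℕ → ℕ) (l m : List ℕ) : List ℕ := l.flatMap fun a => m.map (add a)

/-- Addition of codes. -/
def add (a b : PolyCode) : PolyCode := (a.1 ++ b.1, a.2 ++ b.2)

/-- Multiplication of codes, for the addition `op` of the group. -/
def mul (op : ℕ → ℕ → ℕ) (a b : PolyCode) : PolyCode :=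
  (listMul op a.1 b.1 ++ listMul op a.2 b.2, listMul op a.1 b.2 ++ listMul op a.2 b.1)

/-- Equality of the coded elements. -/
def beq (a b : PolyCode) : Bool := decide ((a.1 ++ b.2).Perm (b.1 ++ a.2))

/-- Renaming of the elements of the group. -/
def map (f : ℕ → ℕ) (a : PolyCode) : PolyCode := (a.1.map f, a.2.map f)

end PolyCode

namespace FracCode

open PolyCode

/-- Fractions with denominator zero are replaced by a code of zero. -/
def normalize (x : FracCode) : FracCode :=
  bif beq x.2 ([], []) then (([], []), ([0], [])) else x

/-- The enumeration of all codes of fractions with nonzero denominator. -/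
def ofNat (n : ℕ) : FracCode := normalize ((Encodable.decode (α := FracCode) n).getD default)

/-- Renaming of the elements of the group. -/
def map (f : ℕ → ℕ) (x : FracCode) : FracCode := (PolyCode.map f x.1, PolyCode.map f x.2)

/-- The test for `x = y`. -/
def beq (op : ℕ → ℕ → ℕ) (x y : FracCode) : Bool :=
  PolyCode.beq (mul op x.1 y.2) (mul op y.1 x.2)

/-- The test for `x + y = z`. -/
def addEq (op : ℕ → ℕ → ℕ) (x y z : FracCode) : Bool :=
  PolyCode.beq (mul op (add (mul op x.1 y.2) (mul op y.1 x.2)) z.2)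
    (mul op z.1 (mul op x.2 y.2))

/-- The test for `x * y = z`. -/
def mulEq (op : ℕ → ℕ → ℕ) (x y z : FracCode) : Bool :=
  PolyCode.beq (mul op (mul op x.1 y.1) z.2) (mul op z.1 (mul op x.2 y.2))

/-- The `n`-th code is not equal to an earlier one. -/
def isNew (op : ℕ → ℕ → ℕ) (n : ℕ) : Bool :=
  decide (Nat.count (fun m => beq op (ofNat n) (ofNat m) = true) n = 0)

/-- The index of the `n`-th code that is not equal to an earlier one. -/
noncomputable def index (op : ℕ → ℕ → ℕ) (n : ℕ) : ℕ := Nat.nth (fun m => isNew op m = true) n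

end FracCode

/-! ### Uniform computability of the operations on codes -/

open UniformlyComputable

theorem primrec_list_count : Primrec₂ fun (l : List ℕ) (a : ℕ) => l.count a := by
  have h : PrimrecRel fun a b : ℕ => a = b := Primrec.eq
  refine (Primrec.list_length.comp₂ h.listFilter).of_eq fun l a => ?_
  rw [List.count_eq_length_filter]
  simp [BEq.beq]

/-- Lists are permutations of each other if their entries have the same multiplicities. -/
theorem primrec_list_perm : Primrec₂ fun l m : List ℕ => decide (l.Perm m) := by
  have h : PrimrecRel fun (a : ℕ) (p : List ℕ × List ℕ) => p.1.count a = p.2.count a :=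
    Primrec.eq.comp (primrec_list_count.comp (Primrec.fst.comp Primrec.snd) Primrec.fst)
      (primrec_list_count.comp (Primrec.snd.comp Primrec.snd) Primrec.fst)
  have h2 : PrimrecPred fun p : List ℕ × List ℕ =>
      ∀ a ∈ p.1 ++ p.2, p.1.count a = p.2.count a :=
    h.forall_mem_list.comp (Primrec.list_append.comp Primrec.fst Primrec.snd) Primrec.id
  have h3 : PrimrecRel fun l m : List ℕ => l.Perm m := h2.of_eq fun p => by
    refine Iff.trans ?_ List.perm_iff_count.symm
    refine ⟨fun h a => ?_, fun h a _ => h a⟩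
    by_cases ha : a ∈ p.1 ++ p.2
    · exact h a ha
    · rw [List.mem_append, not_or] at ha
      rw [List.count_eq_zero_of_not_mem ha.1, List.count_eq_zero_of_not_mem ha.2]
  exact h3.decide

theorem PolyCode.primrec_beq : Primrec₂ PolyCode.beq :=
  primrec_list_perm.comp
    (Primrec.list_append.comp (Primrec.fst.comp Primrec.fst) (Primrec.snd.comp Primrec.snd))
    (Primrec.list_append.comp (Primrec.fst.comp Primrec.snd) (Primrec.snd.comp Primrec.fst))

theorem PolyCode.primrec_add : Primrec₂ PolyCode.add :=
  Primrec.pair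
    (Primrec.list_append.comp (Primrec.fst.comp Primrec.fst) (Primrec.fst.comp Primrec.snd))
    (Primrec.list_append.comp (Primrec.snd.comp Primrec.fst) (Primrec.snd.comp Primrec.snd))

theorem FracCode.primrec_normalize : Primrec FracCode.normalize :=
  Primrec.cond (PolyCode.primrec_beq.comp Primrec.snd (Primrec.const _)) (Primrec.const _)
    Primrec.id

theorem FracCode.primrec_ofNat : Primrec FracCode.ofNat :=
  FracCode.primrec_normalize.comp (Primrec.option_getD.comp Primrec.decode (Primrec.const _))

variable {X : Type*} {o : X → ℕ → ℕ}

namespace UniformlyComputable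

theorem polyCode_map {f : X → ℕ → ℕ} (hf : UniformlyComputable o f) :
    UniformlyComputable o fun x => PolyCode.map (f x) :=
  pair (list_map id.fst (hf.comp id.snd)) (list_map id.snd (hf.comp id.snd))

theorem fracCode_map {f : X → ℕ → ℕ} (hf : UniformlyComputable o f) :
    UniformlyComputable o fun x => FracCode.map (f x) :=
  pair ((polyCode_map hf).comp id.fst) ((polyCode_map hf).comp id.snd)

variable {op : X → ℕ → ℕ → ℕ}

theorem listMul (h : UniformlyComputable₂ o op) :
    UniformlyComputable₂ o fun x => PolyCode.listMul (op x) := by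
  refine list_flatMap (F := fun x (p : List ℕ × List ℕ) a => p.2.map (op x a)) id.fst ?_
  exact list_map (F := fun x (p : (List ℕ × List ℕ) × ℕ) b => op x p.2 b) id.fst.snd
    (comp₂ h id.fst.snd id.snd)

theorem polyCode_mul (h : UniformlyComputable₂ o op) :
    UniformlyComputable₂ o fun x => PolyCode.mul (op x) := by
  have hm := listMul h
  have ha : UniformlyComputable₂ o fun _ (l m : List ℕ) => l ++ m :=
    Primrec.list_append.uniformlyComputable₂
  exact pair
    (comp₂ ha (comp₂ hm id.fst.fst id.snd.fst) (comp₂ hm id.fst.snd id.snd.snd))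
    (comp₂ ha (comp₂ hm id.fst.fst id.snd.snd) (comp₂ hm id.fst.snd id.snd.fst))

theorem fracCode_beq (h : UniformlyComputable₂ o op) :
    UniformlyComputable₂ o fun x => FracCode.beq (op x) := by
  have hm := polyCode_mul h
  have hb : UniformlyComputable₂ o fun _ => PolyCode.beq :=
    PolyCode.primrec_beq.uniformlyComputable₂
  have h1 := comp₂ hb (comp₂ hm (id (α := FracCode × FracCode)).fst.fst id.snd.snd)
    (comp₂ hm id.snd.fst id.fst.snd)
  exact h1

theorem fracCode_addEq (h : UniformlyComputable₂ o op) :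
    UniformlyComputable o fun x (p : FracCode × FracCode × FracCode) =>
      FracCode.addEq (op x) p.1 p.2.1 p.2.2 := by
  have hm := polyCode_mul h
  have hb : UniformlyComputable₂ o fun _ => PolyCode.beq :=
    PolyCode.primrec_beq.uniformlyComputable₂
  have ha : UniformlyComputable₂ o fun _ => PolyCode.add :=
    PolyCode.primrec_add.uniformlyComputable₂
  exact comp₂ hb
    (comp₂ hm (comp₂ ha
      (comp₂ hm id.fst.fst id.snd.fst.snd) (comp₂ hm id.snd.fst.fst id.fst.snd)) id.snd.snd.snd)
    (comp₂ hm id.snd.snd.fst (comp₂ hm id.fst.snd id.snd.fst.snd))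

theorem fracCode_mulEq (h : UniformlyComputable₂ o op) :
    UniformlyComputable o fun x (p : FracCode × FracCode × FracCode) =>
      FracCode.mulEq (op x) p.1 p.2.1 p.2.2 := by
  have hm := polyCode_mul h
  have hb : UniformlyComputable₂ o fun _ => PolyCode.beq :=
    PolyCode.primrec_beq.uniformlyComputable₂
  exact comp₂ hb
    (comp₂ hm (comp₂ hm id.fst.fst id.snd.fst.fst) id.snd.snd.snd)
    (comp₂ hm id.snd.snd.fst (comp₂ hm id.fst.snd id.snd.fst.snd))

theorem fracCode_isNew (h : UniformlyComputable₂ o op) :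
    UniformlyComputable o fun x => FracCode.isNew (op x) := by
  have hc : UniformlyComputable o fun _ => FracCode.ofNat :=
    FracCode.primrec_ofNat.uniformlyComputable
  have h1 : UniformlyComputable₂ o fun x (n m : ℕ) =>
      FracCode.beq (op x) (FracCode.ofNat n) (FracCode.ofNat m) :=
    comp₂ (fracCode_beq h) (hc.comp id.fst) (hc.comp id.snd)
  have h2 := count h1 id
  have h3 : Primrec fun n : ℕ => decide (n = 0) :=
    (Primrec.eq.comp Primrec.id (Primrec.const 0)).decide
  exact h3.uniformlyComputable.comp h2

/-- The `n`-th new code is found by search for a new code with `n` new codes before it. -/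
theorem fracCode_index (h : UniformlyComputable₂ o op)
    (hinf : ∀ x, {n | FracCode.isNew (op x) n = true}.Infinite) :
    UniformlyComputable o fun x => FracCode.index (op x) := by
  have hnew := fracCode_isNew h
  have hcount : UniformlyComputable o fun x (p : ℕ × ℕ) =>
      Nat.count (fun m => FracCode.isNew (op x) m = true) p.2 :=
    count (p := fun x (_ : ℕ × ℕ) m => FracCode.isNew (op x) m) (hnew.comp id.snd) id.snd
  have heq : Primrec₂ fun m n : ℕ => decide (m = n) := Primrec.eq.decide
  refine rfind (p := fun x (p : ℕ × ℕ) => FracCode.isNew (op x) p.2 &&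
    decide (Nat.count (fun m => FracCode.isNew (op x) m = true) p.2 = p.1))
    (comp₂ Primrec.and.uniformlyComputable₂ (hnew.comp id.snd)
      (comp₂ heq.uniformlyComputable₂ hcount id.fst)) fun x n => ⟨?_, fun m hm => ?_⟩
  · have h1 : FracCode.isNew (op x) (FracCode.index (op x) n) = true :=
      Nat.nth_mem_of_infinite (hinf x) n
    have h2 : Nat.count (fun m => FracCode.isNew (op x) m = true) (FracCode.index (op x) n) = n :=
      Nat.count_nth_of_infinite (hinf x) n
    simp [h1, h2]
  · by_contra hne
    simp only [Bool.not_eq_false, Bool.and_eq_true, decide_eq_true_eq] at hne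
    have := Nat.nth_count (p := fun m => FracCode.isNew (op x) m = true) hne.1
    rw [hne.2] at this
    exact hm.ne' this

end UniformlyComputable

end Codes

/-! ### The rational function with a given code -/

section Evaluation

variable {G : Type} [AddCommGroup G] (e : ℕ ≃ G)

/-- The sum of the monomials of the entries of a list. -/
noncomputable def listSum (l : List ℕ) : AddMonoidAlgebra ℚ G :=
  (l.map fun n => AddMonoidAlgebra.single (e n) (1 : ℚ)).sum

/-- The group operation, as a function on the universe `ℕ`. -/
def transportAdd (a b : ℕ) : ℕ := e.symm (e a + e b)

theorem listSum_append (l m : List ℕ) : listSum e (l ++ m) = listSum e l + listSum e m := by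
  simp [listSum]

theorem listSum_cons (n : ℕ) (l : List ℕ) :
    listSum e (n :: l) = AddMonoidAlgebra.single (e n) 1 + listSum e l := by
  simp [listSum]

@[simp] theorem listSum_nil : listSum e [] = 0 := rfl

theorem listSum_map_transportAdd (a : ℕ) (m : List ℕ) :
    listSum e (m.map (transportAdd e a)) = AddMonoidAlgebra.single (e a) 1 * listSum e m := by
  induction m with
  | nil => simp
  | cons b m ih =>
    rw [List.map_cons, listSum_cons, listSum_cons, ih, mul_add,
      AddMonoidAlgebra.single_mul_single, mul_one, transportAdd, e.apply_symm_apply]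

theorem listSum_listMul (l m : List ℕ) :
    listSum e (PolyCode.listMul (transportAdd e) l m) = listSum e l * listSum e m := by
  induction l with
  | nil => simp [PolyCode.listMul]
  | cons a l ih =>
    have h1 : PolyCode.listMul (transportAdd e) (a :: l) m =
        m.map (transportAdd e a) ++ PolyCode.listMul (transportAdd e) l m := rfl
    rw [h1, listSum_append, ih, listSum_map_transportAdd, listSum_cons, add_mul]

theorem coeff_listSum (l : List ℕ) (n : ℕ) : (listSum e l).coeff (e n) = l.count n := by
  classical
  induction l with
  | nil => simp
  | cons a l ih =>
    rw [listSum_cons, AddMonoidAlgebra.coeff_add, Finsupp.add_apply, ih,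
      AddMonoidAlgebra.coeff_single, Finsupp.single_apply, List.count_cons]
    by_cases h : a = n <;> simp [h, add_comm]

theorem listSum_eq_iff {l m : List ℕ} : listSum e l = listSum e m ↔ l.Perm m := by
  rw [List.perm_iff_count]
  constructor
  · intro h n
    have h1 := coeff_listSum e l n
    rw [h, coeff_listSum] at h1
    exact_mod_cast h1.symm
  · intro h
    refine AddMonoidAlgebra.coeff_injective (Finsupp.ext fun g => ?_)
    obtain ⟨n, rfl⟩ := e.surjective g
    rw [coeff_listSum, coeff_listSum, h]

namespace PolyCode

/-- The element of the group algebra with a given code. -/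
noncomputable def eval (a : PolyCode) : AddMonoidAlgebra ℚ G := listSum e a.1 - listSum e a.2

theorem eval_add (a b : PolyCode) : eval e (add a b) = eval e a + eval e b := by
  simp only [eval, add, listSum_append]
  ring

theorem eval_mul (a b : PolyCode) :
    eval e (mul (transportAdd e) a b) = eval e a * eval e b := by
  simp only [eval, mul, listSum_append, listSum_listMul]
  ring

theorem beq_iff {a b : PolyCode} : beq a b = true ↔ eval e a = eval e b := by
  rw [beq, decide_eq_true_iff, ← listSum_eq_iff e, listSum_append, listSum_append, eval, eval,
    sub_eq_sub_iff_add_eq_add]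

/-- The coded elements are the integral ones, hence every element has a multiple with a code. -/
theorem exists_eval_eq_smul (x : AddMonoidAlgebra ℚ G) :
    ∃ (n : ℕ) (a : PolyCode), n ≠ 0 ∧ eval e a = (n : ℚ) • x := by
  have hneg : ∀ a : PolyCode, eval e (a.2, a.1) = -eval e a := fun a => by simp [eval]
  have hmul : ∀ (n : ℕ) (a : PolyCode), ∃ b, eval e b = (n : ℚ) • eval e a := by
    intro n a
    induction n with
    | zero => exact ⟨([], []), by simp [eval]⟩
    | succ n ih =>
      obtain ⟨b, hb⟩ := ih
      exact ⟨add b a, by rw [eval_add, hb, Nat.cast_succ, add_smul, one_smul]⟩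
  induction x using AddMonoidAlgebra.induction_linear with
  | zero => exact ⟨1, ([], []), one_ne_zero, by simp [eval]⟩
  | add x y hx hy =>
    obtain ⟨m, a, hm, ha⟩ := hx
    obtain ⟨n, b, hn, hb⟩ := hy
    obtain ⟨a', ha'⟩ := hmul n a
    obtain ⟨b', hb'⟩ := hmul m b
    refine ⟨m * n, add a' b', mul_ne_zero hm hn, ?_⟩
    rw [eval_add, ha', hb', ha, hb, smul_smul, smul_smul, smul_add, Nat.cast_mul,
      mul_comm (n : ℚ) (m : ℚ)]
  | single g q =>
    have h1 : eval e ([e.symm g], []) = AddMonoidAlgebra.single g 1 := by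
      simp [eval, listSum]
    obtain ⟨b, hb⟩ := hmul q.num.natAbs ([e.symm g], [])
    have hden : (q.den : ℚ) • AddMonoidAlgebra.single g q =
        AddMonoidAlgebra.single g ((q.num : ℤ) : ℚ) := by
      rw [AddMonoidAlgebra.smul_single, smul_eq_mul, Rat.den_mul_eq_num]
    rw [h1, AddMonoidAlgebra.smul_single, smul_eq_mul, mul_one] at hb
    rcases Int.natAbs_eq q.num with h | h
    · exact ⟨q.den, b, q.den_nz, by rw [hb, hden, h, Int.natAbs_natCast, Int.cast_natCast]⟩
    · exact ⟨q.den, (b.2, b.1), q.den_nz, by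
        rw [hneg, hb, hden, h, Int.natAbs_neg, Int.natAbs_natCast, Int.cast_neg, Int.cast_natCast,
          AddMonoidAlgebra.single_neg]⟩

end PolyCode

variable (K : Type) [Field K] [Algebra (AddMonoidAlgebra ℚ G) K]

namespace FracCode

/-- The rational function with a given code; the junk value `0` for denominator zero is the value of
the code that `normalize` substitutes. -/
noncomputable def eval (x : FracCode) : K :=
  algebraMap (AddMonoidAlgebra ℚ G) K (x.1.eval e) /
    algebraMap (AddMonoidAlgebra ℚ G) K (x.2.eval e)

theorem normalize_of_ne_zero {x : FracCode} (h : x.2.eval e ≠ 0) : normalize x = x := by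
  have h0 : PolyCode.eval e ([], []) = 0 := by simp [PolyCode.eval]
  have : PolyCode.beq x.2 ([], []) = false := by
    rw [Bool.eq_false_iff, Ne, PolyCode.beq_iff e, h0]
    exact h
  rw [normalize, this, cond_false]

theorem eval_normalize_snd_ne_zero (x : FracCode) : (normalize x).2.eval e ≠ 0 := by
  have h0 : PolyCode.eval e ([], []) = 0 := by simp [PolyCode.eval]
  by_cases h : x.2.eval e = 0
  · have : PolyCode.beq x.2 ([], []) = true := (PolyCode.beq_iff e).2 (h.trans h0.symm)
    rw [normalize, this, cond_true]
    simp [PolyCode.eval, listSum]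
  · rwa [normalize_of_ne_zero e h]

theorem eval_ofNat_snd_ne_zero (n : ℕ) : (ofNat n).2.eval e ≠ 0 :=
  eval_normalize_snd_ne_zero e _

variable [IsFractionRing (AddMonoidAlgebra ℚ G) K]

theorem algebraMap_ne_zero {a : AddMonoidAlgebra ℚ G} (h : a ≠ 0) :
    algebraMap (AddMonoidAlgebra ℚ G) K a ≠ 0 := by
  rwa [Ne, map_eq_zero_iff _ (IsFractionRing.injective (AddMonoidAlgebra ℚ G) K)]

theorem beq_iff {x y : FracCode} (hx : x.2.eval e ≠ 0) (hy : y.2.eval e ≠ 0) :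
    beq (transportAdd e) x y = true ↔ eval e K x = eval e K y := by
  rw [beq, PolyCode.beq_iff e, PolyCode.eval_mul, PolyCode.eval_mul, eval, eval,
    div_eq_div_iff (algebraMap_ne_zero K hx) (algebraMap_ne_zero K hy), ← map_mul, ← map_mul,
    (IsFractionRing.injective (AddMonoidAlgebra ℚ G) K).eq_iff]

theorem addEq_iff {x y z : FracCode} (hx : x.2.eval e ≠ 0) (hy : y.2.eval e ≠ 0)
    (hz : z.2.eval e ≠ 0) :
    addEq (transportAdd e) x y z = true ↔ eval e K x + eval e K y = eval e K z := by
  have hx' := algebraMap_ne_zero K hx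
  have hy' := algebraMap_ne_zero K hy
  rw [addEq, PolyCode.beq_iff e]
  simp only [PolyCode.eval_mul, PolyCode.eval_add]
  rw [eval, eval, eval, div_add_div _ _ hx' hy',
    div_eq_div_iff (mul_ne_zero hx' hy') (algebraMap_ne_zero K hz),
    ← (IsFractionRing.injective (AddMonoidAlgebra ℚ G) K).eq_iff]
  simp only [map_mul, map_add]
  rw [mul_comm (algebraMap (AddMonoidAlgebra ℚ G) K (y.1.eval e))]

theorem mulEq_iff {x y z : FracCode} (hx : x.2.eval e ≠ 0) (hy : y.2.eval e ≠ 0)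
    (hz : z.2.eval e ≠ 0) :
    mulEq (transportAdd e) x y z = true ↔ eval e K x * eval e K y = eval e K z := by
  have hx' := algebraMap_ne_zero K hx
  have hy' := algebraMap_ne_zero K hy
  rw [mulEq, PolyCode.beq_iff e]
  simp only [PolyCode.eval_mul]
  rw [eval, eval, eval, div_mul_div_comm,
    div_eq_div_iff (mul_ne_zero hx' hy') (algebraMap_ne_zero K hz),
    ← (IsFractionRing.injective (AddMonoidAlgebra ℚ G) K).eq_iff]
  simp only [map_mul]

theorem eval_ofNat_surjective : Function.Surjective fun n => eval e K (ofNat n) := by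
  have hsmul : ∀ (q : ℚ) (a : AddMonoidAlgebra ℚ G), algebraMap _ K (q • a) =
      algebraMap _ K (algebraMap ℚ (AddMonoidAlgebra ℚ G) q) * algebraMap _ K a := fun q a => by
    rw [Algebra.smul_def, map_mul]
  intro z
  obtain ⟨x, y, hy, rfl⟩ := IsFractionRing.div_surjective (A := AddMonoidAlgebra ℚ G) z
  have hy0 := nonZeroDivisors.ne_zero hy
  obtain ⟨m, a, hm, ha⟩ := PolyCode.exists_eval_eq_smul e x
  obtain ⟨n, b, hn, hb⟩ := PolyCode.exists_eval_eq_smul e ((m : ℚ) • y)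
  obtain ⟨c, hc⟩ : ∃ c, PolyCode.eval e c = (n : ℚ) • PolyCode.eval e a := by
    refine ⟨PolyCode.mul (transportAdd e) (List.replicate n (e.symm 0), []) a, ?_⟩
    have : listSum e (List.replicate n (e.symm 0)) = algebraMap ℚ _ (n : ℚ) := by
      rw [listSum, List.map_replicate, List.sum_replicate, e.apply_symm_apply, map_natCast,
        nsmul_eq_mul, ← AddMonoidAlgebra.one_def, mul_one]
    rw [PolyCode.eval_mul, Algebra.smul_def, ← this, PolyCode.eval, listSum_nil, sub_zero]
  have hm' : (m : ℚ) ≠ 0 := Nat.cast_ne_zero.2 hm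
  have hn' : (n : ℚ) ≠ 0 := Nat.cast_ne_zero.2 hn
  have hb0 : PolyCode.eval e b ≠ 0 := by
    rw [hb]
    exact smul_ne_zero hn' (smul_ne_zero hm' hy0)
  refine ⟨Encodable.encode ((c, b) : FracCode), ?_⟩
  have h1 : ofNat (Encodable.encode ((c, b) : FracCode)) = (c, b) := by
    rw [ofNat, Encodable.encodek, Option.getD_some]
    exact normalize_of_ne_zero e hb0
  have hq : ∀ q : ℚ, q ≠ 0 → algebraMap (AddMonoidAlgebra ℚ G) K (algebraMap ℚ _ q) ≠ 0 :=
    fun q hq => algebraMap_ne_zero K ((map_ne_zero_iff _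
      (algebraMap ℚ (AddMonoidAlgebra ℚ G)).injective).2 hq)
  simp only [h1, eval]
  rw [hc, hb, ha, hsmul, hsmul, hsmul, hsmul, mul_div_mul_left _ _ (hq _ hn'),
    mul_div_mul_left _ _ (hq _ hm')]

theorem isNew_iff {n : ℕ} : isNew (transportAdd e) n = true ↔
    ∀ m < n, eval e K (ofNat n) ≠ eval e K (ofNat m) := by
  rw [isNew, decide_eq_true_iff, Nat.count_iff_forall_not]
  simp only [beq_iff e K (eval_ofNat_snd_ne_zero e _) (eval_ofNat_snd_ne_zero e _)]

theorem exists_isNew_eval_eq (z : K) :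
    ∃ n, isNew (transportAdd e) n = true ∧ eval e K (ofNat n) = z := by
  classical
  have hex : ∃ n, eval e K (ofNat n) = z := eval_ofNat_surjective e K z
  refine ⟨Nat.find hex, (isNew_iff e K).2 fun m hm h => Nat.find_min hex hm ?_,
    Nat.find_spec hex⟩
  rw [← h, Nat.find_spec hex]

theorem infinite_isNew (K : Type) [Field K] [Algebra (AddMonoidAlgebra ℚ G) K]
    [IsFractionRing (AddMonoidAlgebra ℚ G) K] :
    {n | isNew (transportAdd e) n = true}.Infinite := by
  have := charZero_of_algebra_addMonoidAlgebra G K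
  have : Infinite K := Infinite.of_injective _ (Nat.cast_injective (R := K))
  intro hfin
  refine Set.infinite_univ (α := K) ((hfin.image fun n => eval e K (ofNat n)).subset ?_)
  intro z _
  exact exists_isNew_eval_eq e K z

/-- The bijection from `ℕ` to the field of fractions: the codes that are not equal to an earlier
one, in increasing order. -/
noncomputable def enumeration : ℕ ≃ K :=
  Equiv.ofBijective (fun n => eval e K (ofNat (index (transportAdd e) n))) (by
    have hinf := infinite_isNew e K
    have hnew : ∀ n, isNew (transportAdd e) (index (transportAdd e) n) = true := fun n =>
      Nat.nth_mem_of_infinite hinf n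
    refine ⟨fun m n h => ?_, fun z => ?_⟩
    · have hle : ∀ a b, index (transportAdd e) a < index (transportAdd e) b →
          eval e K (ofNat (index (transportAdd e) b)) ≠
            eval e K (ofNat (index (transportAdd e) a)) := fun a b hab =>
        (isNew_iff e K).1 (hnew b) _ hab
      rcases lt_trichotomy (index (transportAdd e) m) (index (transportAdd e) n) with h' | h' | h'
      · exact absurd h.symm (hle _ _ h')
      · exact Nat.nth_injective hinf h'
      · exact absurd h (hle _ _ h')
    · obtain ⟨n, hn, rfl⟩ := exists_isNew_eval_eq e K z
      refine ⟨Nat.count (fun m => isNew (transportAdd e) m = true) n, ?_⟩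
      change eval e K (ofNat (Nat.nth (fun m => isNew (transportAdd e) m = true) _)) = _
      rw [Nat.nth_count hn])

/-- The code of the `n`-th element of the field. -/
noncomputable def code (n : ℕ) : FracCode := ofNat (index (transportAdd e) n)

theorem enumeration_apply (n : ℕ) : enumeration e K n = eval e K (code e n) := rfl

theorem eval_code_snd_ne_zero (n : ℕ) : (code e n).2.eval e ≠ 0 := eval_ofNat_snd_ne_zero e _

end FracCode

section Map

variable {K} {G' : Type} [AddCommGroup G'] (e' : ℕ ≃ G') {K' : Type} [Field K']
  [Algebra (AddMonoidAlgebra ℚ G') K'] {f : ℕ → ℕ} {φ : K →+* K'}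

theorem map_algebraMap_eval
    (h : ∀ n, φ (fieldMonomial K (e n)) = fieldMonomial K' (e' (f n))) (a : PolyCode) :
    φ (algebraMap (AddMonoidAlgebra ℚ G) K (a.eval e)) =
      algebraMap (AddMonoidAlgebra ℚ G') K' ((a.map f).eval e') := by
  have key : ∀ l : List ℕ, φ (algebraMap (AddMonoidAlgebra ℚ G) K (listSum e l)) =
      algebraMap (AddMonoidAlgebra ℚ G') K' (listSum e' (l.map f)) := by
    intro l
    induction l with
    | nil => simp
    | cons n l ih =>
      rw [List.map_cons, listSum_cons, listSum_cons, map_add, map_add, map_add, ih]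
      exact congrArg (· + _) (h n)
  simp only [PolyCode.eval, PolyCode.map, map_sub, key]

theorem map_eval (h : ∀ n, φ (fieldMonomial K (e n)) = fieldMonomial K' (e' (f n)))
    (x : FracCode) : φ (x.eval e K) = (x.map f).eval e' K' := by
  rw [FracCode.eval, FracCode.eval, map_div₀, map_algebraMap_eval e e' h,
    map_algebraMap_eval e e' h]
  rfl

theorem eval_map_snd_ne_zero [IsFractionRing (AddMonoidAlgebra ℚ G) K]
    (h : ∀ n, φ (fieldMonomial K (e n)) = fieldMonomial K' (e' (f n))) {x : FracCode}
    (hx : x.2.eval e ≠ 0) : (x.map f).2.eval e' ≠ 0 := by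
  intro h0
  have h1 := map_algebraMap_eval e e' h x.2
  have h2 : (x.2.map f).eval e' = 0 := h0
  rw [h2, map_zero, map_eq_zero_iff _ φ.injective] at h1
  exact FracCode.algebraMap_ne_zero K hx h1

end Map

end Evaluation

/-! ### The functor -/

section Functor

variable {r : ℕ}

instance TFAb.isAddTorsionFree (G : TFAb r) : IsAddTorsionFree G := G.isTorsionFreeOfRank.1

theorem TFAb.rank_eq (G : TFAb r) : Module.rank ℤ G = r := G.isTorsionFreeOfRank.2

theorem IsCharZeroOfTrdeg.of_ringEquiv {F F' : Type} [Field F] [Field F'] (f : F ≃+* F')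
    (h : IsCharZeroOfTrdeg r F) : IsCharZeroOfTrdeg r F' := by
  obtain ⟨h0, h⟩ := h
  have h1 : CharZero F' := charZero_of_injective_ringHom (f := f.toRingHom) f.injective
  refine ⟨h1, ?_⟩
  have e : F ≃ₐ[ℚ] F' := AlgEquiv.ofRingEquiv (f := f) fun q => by
    rw [eq_ratCast, eq_ratCast, map_ratCast]
  rw [← h, e.trdeg_eq]

theorem IsCharZeroOfTrdeg.transport {F α : Type} [Field F] (f : α ≃ F)
    (h : IsCharZeroOfTrdeg r F) : @IsCharZeroOfTrdeg r α f.field :=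
  let _ := f.field
  h.of_ringEquiv f.ringEquiv.symm

theorem isCharZeroOfTrdeg_of_rank_eq {G : Type} [AddCommGroup G] [IsAddTorsionFree G]
    (h : Module.rank ℤ G = r) (K : Type) [Field K] [Algebra (AddMonoidAlgebra ℚ G) K]
    [IsFractionRing (AddMonoidAlgebra ℚ G) K] : IsCharZeroOfTrdeg r K :=
  have := charZero_of_algebra_addMonoidAlgebra G K
  ⟨this, trdeg_eq_of_rank_eq h K⟩

/-- The field of fractions of `ℚ[G]`, with universe `ℕ`. -/
noncomputable def fractionField (G : TFAb r) : FD r where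
  field := (FracCode.enumeration G.elt (GroupRingFractions G)).field
  isCharZeroOfTrdeg := (isCharZeroOfTrdeg_of_rank_eq G.rank_eq (GroupRingFractions G)).transport _

/-- The identification of the field of fractions of `ℚ[G]` with its copy on `ℕ`. -/
noncomputable def fractionFieldEquiv (G : TFAb r) : GroupRingFractions G ≃+* fractionField G where
  toEquiv := (FracCode.enumeration G.elt (GroupRingFractions G)).symm.trans (fractionField G).elt
  map_mul' x y := by
    let f := FracCode.enumeration G.elt (GroupRingFractions G)
    change f.symm (x * y) = f.symm (f (f.symm x) * f (f.symm y))
    rw [f.apply_symm_apply, f.apply_symm_apply]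
  map_add' x y := by
    let f := FracCode.enumeration G.elt (GroupRingFractions G)
    change f.symm (x + y) = f.symm (f (f.symm x) + f (f.symm y))
    rw [f.apply_symm_apply, f.apply_symm_apply]

theorem fractionFieldEquiv_symm_elt (G : TFAb r) (n : ℕ) :
    (fractionFieldEquiv G).symm ((fractionField G).elt n) =
      FracCode.enumeration G.elt (GroupRingFractions G) n := rfl

/-- The isomorphism of fields of fractions induced by an isomorphism of groups. -/
noncomputable def groupRingFractionsMap {G G' : TFAb r} (f : G ≃+ G') :
    GroupRingFractions G ≃+* GroupRingFractions G' :=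
  IsFractionRing.ringEquivOfRingEquiv (AddMonoidAlgebra.mapDomainRingEquiv ℚ f)

theorem groupRingFractionsMap_monomialY {G G' : TFAb r} (f : G ≃+ G') (g : G) :
    groupRingFractionsMap f (monomialY G g) = monomialY G' (f g) := by
  rw [groupRingFractionsMap, monomialY, IsFractionRing.ringEquivOfRingEquiv_algebraMap, monomialY]
  simp

theorem groupRingFractions_ringHom_ext {G G' : TFAb r}
    {φ ψ : GroupRingFractions G →+* GroupRingFractions G'}
    (h : ∀ g, φ (monomialY G g) = ψ (monomialY G g)) : φ = ψ := by
  refine IsLocalization.ringHom_ext (nonZeroDivisors (AddMonoidAlgebra ℚ G))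
    (AddMonoidAlgebra.ringHom_ext (fun q => ?_) h)
  have h1 : ∀ χ : GroupRingFractions G →+* GroupRingFractions G',
      χ (algebraMap (AddMonoidAlgebra ℚ G) _ (AddMonoidAlgebra.single 0 q)) = q := fun χ =>
    map_ratCast ((χ.comp (algebraMap (AddMonoidAlgebra ℚ G) _)).comp
      AddMonoidAlgebra.singleZeroRingHom) q
  exact (h1 φ).trans (h1 ψ).symm

theorem groupRingFractionsMap_refl (G : TFAb r) :
    groupRingFractionsMap (AddEquiv.refl G) = RingEquiv.refl _ := by
  refine RingEquiv.toRingHom_injective (groupRingFractions_ringHom_ext fun g => ?_)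
  exact groupRingFractionsMap_monomialY _ g

theorem groupRingFractionsMap_trans {G G' G'' : TFAb r} (f : G ≃+ G') (g : G' ≃+ G'') :
    groupRingFractionsMap (f.trans g) =
      (groupRingFractionsMap f).trans (groupRingFractionsMap g) := by
  refine RingEquiv.toRingHom_injective (groupRingFractions_ringHom_ext fun x => ?_)
  refine (groupRingFractionsMap_monomialY _ x).trans ?_
  change _ = groupRingFractionsMap g (groupRingFractionsMap f (monomialY G x))
  rw [groupRingFractionsMap_monomialY, groupRingFractionsMap_monomialY]
  rfl

/-- The isomorphism of the copies on `ℕ` that is induced by an isomorphism of groups. -/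
noncomputable def fractionFieldMap (G G' : TFAb r) (f : G ≃+ G') :
    fractionField G ≃+* fractionField G' :=
  (fractionFieldEquiv G).symm.trans ((groupRingFractionsMap f).trans (fractionFieldEquiv G'))

end Functor

/-! ### Computability of the functor -/

section Computability

open UniformlyComputable

/-- The addition of a group is found by search in the atomic diagram. -/
theorem uniformlyComputable₂_transportAdd {X : Type*} {o : X → ℕ → ℕ} {s : X → ℕ}
    (G : ∀ x, TFAb (s x)) (h : UniformlyComputable o fun x => (G x).diagram) :
    UniformlyComputable₂ o fun x => transportAdd (G x).elt := by
  have hcode : Primrec fun p : (ℕ × ℕ) × ℕ => Nat.pair p.1.1 (Nat.pair p.1.2 p.2) :=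
    Primrec₂.natPair.comp (Primrec.fst.comp Primrec.fst)
      (Primrec₂.natPair.comp (Primrec.snd.comp Primrec.fst) Primrec.snd)
  have htest : Primrec fun n : ℕ => decide (n = 1) :=
    (Primrec.eq.comp Primrec.id (Primrec.const 1)).decide
  have hp : UniformlyComputable o fun x (p : (ℕ × ℕ) × ℕ) =>
      decide ((G x).diagram (Nat.pair p.1.1 (Nat.pair p.1.2 p.2)) = 1) :=
    htest.uniformlyComputable.comp (h.comp hcode.uniformlyComputable)
  have hval : ∀ x a b c, decide ((G x).diagram (Nat.pair a (Nat.pair b c)) = 1) =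
      decide (transportAdd (G x).elt a b = c) := by
    intro x a b c
    simp only [TFAb.diagram, Nat.unpair_pair, transportAdd]
    split_ifs with h <;> simp [h]
  refine rfind hp fun x p => ⟨?_, fun m hm => ?_⟩
  · rw [hval]
    simp
  · rw [hval]
    simpa using hm.ne'

theorem uniformlyComputable_code {X : Type*} {o : X → ℕ → ℕ} {s : X → ℕ}
    (G : ∀ x, TFAb (s x)) (h : UniformlyComputable o fun x => (G x).diagram) :
    UniformlyComputable o fun x => FracCode.code (G x).elt :=
  (FracCode.primrec_ofNat.uniformlyComputable).comp
    (fracCode_index (uniformlyComputable₂_transportAdd G h)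
      fun x => FracCode.infinite_isNew (G x).elt (GroupRingFractions (G x)))

theorem fractionField_addDiagram {r : ℕ} (G : TFAb r) (n : ℕ) :
    (fractionField G).addDiagram n =
      bif FracCode.addEq (transportAdd G.elt) (FracCode.code G.elt n.unpair.1)
        (FracCode.code G.elt n.unpair.2.unpair.1) (FracCode.code G.elt n.unpair.2.unpair.2)
      then 1 else 0 := by
  have h : FracCode.addEq (transportAdd G.elt) (FracCode.code G.elt n.unpair.1)
        (FracCode.code G.elt n.unpair.2.unpair.1) (FracCode.code G.elt n.unpair.2.unpair.2) = true ↔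
      (fractionField G).elt.symm ((fractionField G).elt n.unpair.1 +
        (fractionField G).elt n.unpair.2.unpair.1) = n.unpair.2.unpair.2 := by
    rw [FracCode.addEq_iff G.elt (GroupRingFractions G) (FracCode.eval_code_snd_ne_zero _ _)
      (FracCode.eval_code_snd_ne_zero _ _) (FracCode.eval_code_snd_ne_zero _ _),
      Equiv.symm_apply_eq, ← (fractionFieldEquiv G).symm.injective.eq_iff, map_add]
    simp only [fractionFieldEquiv_symm_elt, FracCode.enumeration_apply]
  rw [FD.addDiagram]
  split_ifs with h1
  · rw [h.2 h1, cond_true]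
  · rw [Bool.eq_false_iff.2 (fun h2 => h1 (h.1 h2)), cond_false]

theorem fractionField_mulDiagram {r : ℕ} (G : TFAb r) (n : ℕ) :
    (fractionField G).mulDiagram n =
      bif FracCode.mulEq (transportAdd G.elt) (FracCode.code G.elt n.unpair.1)
        (FracCode.code G.elt n.unpair.2.unpair.1) (FracCode.code G.elt n.unpair.2.unpair.2)
      then 1 else 0 := by
  have h : FracCode.mulEq (transportAdd G.elt) (FracCode.code G.elt n.unpair.1)
        (FracCode.code G.elt n.unpair.2.unpair.1) (FracCode.code G.elt n.unpair.2.unpair.2) = true ↔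
      (fractionField G).elt.symm ((fractionField G).elt n.unpair.1 *
        (fractionField G).elt n.unpair.2.unpair.1) = n.unpair.2.unpair.2 := by
    rw [FracCode.mulEq_iff G.elt (GroupRingFractions G) (FracCode.eval_code_snd_ne_zero _ _)
      (FracCode.eval_code_snd_ne_zero _ _) (FracCode.eval_code_snd_ne_zero _ _),
      Equiv.symm_apply_eq, ← (fractionFieldEquiv G).symm.injective.eq_iff, map_mul]
    simp only [fractionFieldEquiv_symm_elt, FracCode.enumeration_apply]
  rw [FD.mulDiagram]
  split_ifs with h1
  · rw [h.2 h1, cond_true]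
  · rw [Bool.eq_false_iff.2 (fun h2 => h1 (h.1 h2)), cond_false]

/-- A question about the diagram of the field is a test on three codes. -/
theorem uniformlyComputable_fractionField_diagram :
    UniformlyComputable (fun x : Σ r, TFAb r => x.2.diagram)
      fun x => (fractionField x.2).diagram := by
  have hG : UniformlyComputable (fun x : Σ r, TFAb r => x.2.diagram) fun x => x.2.diagram := query
  have hop := uniformlyComputable₂_transportAdd (fun x : Σ r, TFAb r => x.2) hG
  have hcode := uniformlyComputable_code (fun x : Σ r, TFAb r => x.2) hG
  have hargs : UniformlyComputable (fun x : Σ r, TFAb r => x.2.diagram) fun x (n : ℕ) =>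
      (FracCode.code x.2.elt n.unpair.1, FracCode.code x.2.elt n.unpair.2.unpair.1,
        FracCode.code x.2.elt n.unpair.2.unpair.2) := by
    have hu : UniformlyComputable (fun x : Σ r, TFAb r => x.2.diagram) fun _ => Nat.unpair :=
      Primrec.unpair.uniformlyComputable
    exact pair (hcode.comp hu.fst) (pair (hcode.comp (hu.comp hu.snd).fst)
      (hcode.comp (hu.comp hu.snd).snd))
  have hadd : UniformlyComputable (fun x : Σ r, TFAb r => x.2.diagram)
      fun x => (fractionField x.2).addDiagram :=
    (bcond ((fracCode_addEq hop).comp hargs) (Primrec.const 1).uniformlyComputable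
      (Primrec.const 0).uniformlyComputable).of_eq
        fun x n => (fractionField_addDiagram x.2 n).symm
  have hmul : UniformlyComputable (fun x : Σ r, TFAb r => x.2.diagram)
      fun x => (fractionField x.2).mulDiagram :=
    (bcond ((fracCode_mulEq hop).comp hargs) (Primrec.const 1).uniformlyComputable
      (Primrec.const 0).uniformlyComputable).of_eq
        fun x n => (fractionField_mulDiagram x.2 n).symm
  have hdiv : Primrec fun n : ℕ => n / 2 := Primrec.nat_div.comp Primrec.id (Primrec.const 2)
  have hmod : Primrec fun n : ℕ => decide (n % 2 = 0) :=
    (Primrec.eq.comp (Primrec.nat_mod.comp Primrec.id (Primrec.const 2)) (Primrec.const 0)).decide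
  refine (bcond hmod.uniformlyComputable (hadd.comp hdiv.uniformlyComputable)
    (hmul.comp hdiv.uniformlyComputable)).of_eq fun x n => ?_
  rw [FD.diagram, oracleJoin, Bool.cond_decide]

theorem oracleJoin_left (A B : ℕ → ℕ) (n : ℕ) : oracleJoin A B (2 * n) = A n := by
  simp [oracleJoin]

theorem oracleJoin_right (A B : ℕ → ℕ) (n : ℕ) : oracleJoin A B (2 * n + 1) = B n := by
  have h1 : (2 * n + 1) % 2 = 1 := by omega
  have h2 : (2 * n + 1) / 2 = n := by omega
  simp [oracleJoin, h1, h2]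

namespace UniformlyComputable

variable {X : Type*} {o A B : X → ℕ → ℕ}

theorem of_oracleJoin_left (h : UniformlyComputable o fun x => oracleJoin (A x) (B x)) :
    UniformlyComputable o A :=
  (h.comp (Primrec.nat_mul.comp (Primrec.const 2) Primrec.id).uniformlyComputable).of_eq
    fun _ n => oracleJoin_left _ _ n

theorem of_oracleJoin_right (h : UniformlyComputable o fun x => oracleJoin (A x) (B x)) :
    UniformlyComputable o B :=
  (h.comp (Primrec.succ.comp
    (Primrec.nat_mul.comp (Primrec.const 2) Primrec.id)).uniformlyComputable).of_eq
    fun _ n => oracleJoin_right _ _ n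

end UniformlyComputable

theorem fractionFieldMap_isoFun_eq_iff {r : ℕ} {G G' : TFAb r} (f : G ≃+ G') (n m : ℕ) :
    FracCode.beq (transportAdd G'.elt) (FracCode.map (TFAb.isoFun f) (FracCode.code G.elt n))
        (FracCode.code G'.elt m) = true ↔ FD.isoFun (fractionFieldMap G G' f) n = m := by
  have h : ∀ n, (groupRingFractionsMap f).toRingHom
      (fieldMonomial (GroupRingFractions G) (G.elt n)) =
        fieldMonomial (GroupRingFractions G') (G'.elt (TFAb.isoFun f n)) := fun n =>
    (groupRingFractionsMap_monomialY f (G.elt n)).trans (by rw [TFAb.isoFun]; simp; rfl)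
  rw [FracCode.beq_iff G'.elt (GroupRingFractions G')
    (eval_map_snd_ne_zero G.elt G'.elt h (FracCode.eval_code_snd_ne_zero _ _))
    (FracCode.eval_code_snd_ne_zero _ _), ← map_eval G.elt G'.elt h,
    ← FracCode.enumeration_apply, ← FracCode.enumeration_apply, FD.isoFun, Equiv.symm_apply_eq,
    ← (fractionFieldEquiv G').symm.injective.eq_iff, fractionFieldEquiv_symm_elt]
  simp only [fractionFieldMap, RingEquiv.trans_apply, RingEquiv.symm_apply_apply,
    fractionFieldEquiv_symm_elt]
  rfl

/-- The isomorphism of fields is found by search for the element with the renamed code. -/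
theorem uniformlyComputable_fractionFieldMap :
    UniformlyComputable
      (fun x : Σ r, Σ G G' : TFAb r, G ≃+ G' =>
        oracleJoin (oracleJoin x.2.1.diagram (TFAb.isoFun x.2.2.2)) x.2.2.1.diagram)
      fun x => FD.isoFun (fractionFieldMap x.2.1 x.2.2.1 x.2.2.2) := by
  set o := (fun x : Σ r, Σ G G' : TFAb r, G ≃+ G' =>
        oracleJoin (oracleJoin x.2.1.diagram (TFAb.isoFun x.2.2.2)) x.2.2.1.diagram) with ho
  have hq : UniformlyComputable o fun x => oracleJoin
      (oracleJoin x.2.1.diagram (TFAb.isoFun x.2.2.2)) x.2.2.1.diagram := query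
  have hG' := of_oracleJoin_right hq
  have hG := of_oracleJoin_left (of_oracleJoin_left hq)
  have hf := of_oracleJoin_right (of_oracleJoin_left hq)
  have hcode := uniformlyComputable_code (fun x : Σ r, Σ G G' : TFAb r, G ≃+ G' => x.2.1) hG
  have hcode' := uniformlyComputable_code (fun x : Σ r, Σ G G' : TFAb r, G ≃+ G' => x.2.2.1) hG'
  have hop' := uniformlyComputable₂_transportAdd
    (fun x : Σ r, Σ G G' : TFAb r, G ≃+ G' => x.2.2.1) hG'
  have hmap : UniformlyComputable o fun x (p : ℕ × ℕ) =>
      FracCode.map (TFAb.isoFun x.2.2.2) (FracCode.code x.2.1.elt p.1) :=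
    (fracCode_map hf).comp (hcode.comp id.fst)
  refine rfind (comp₂ (fracCode_beq hop') hmap (hcode'.comp id.snd)) fun x n => ⟨?_, fun m hm => ?_⟩
  · exact (fractionFieldMap_isoFun_eq_iff x.2.2.2 n _).2 rfl
  · rw [Bool.eq_false_iff, Ne, fractionFieldMap_isoFun_eq_iff]
    exact hm.ne'

/-- A functional may ignore the first component of its input. -/
theorem UniformlyComputable.exists_functional_pair {X : Type*} {o F : X → ℕ → ℕ}
    (h : UniformlyComputable o F) :
    ∃ P, IsTuringFunctional P ∧ ∀ x r n, P (o x) (Nat.pair r n) = Part.some (F x n) := by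
  obtain ⟨P, hP, hPc⟩ := h.comp (Primrec.snd (α := ℕ) (β := ℕ)).uniformlyComputable
  refine ⟨P, hP, fun x r n => ?_⟩
  have := hPc x (r, n)
  rwa [Encodable.encode_prod_val, Encodable.encode_nat, Encodable.encode_nat,
    Encodable.encode_nat] at this

end Computability

/-! ### The embedding -/

/-- The description of all isomorphisms between the fields with universe `ℕ`, transferred from the
fields of fractions. -/
theorem exists_monomial_matching {r : ℕ} (G G' : TFAb r)
    (φ : fractionField G ≃+* fractionField G') :
    ∃ (H : AddSubgroup G) (H' : AddSubgroup G') (e : H ≃+ H') (k : ℕ),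
      (∀ g : G, g ∈ H ↔ ∃ (c : ℚ) (g' : G'), φ (fractionFieldEquiv G (monomialY G g)) =
        (c : fractionField G') * fractionFieldEquiv G' (monomialY G' g')) ∧
      (∀ g' : G', g' ∈ H' ↔ ∃ (c : ℚ) (g : G), φ.symm (fractionFieldEquiv G' (monomialY G' g')) =
        (c : fractionField G) * fractionFieldEquiv G (monomialY G g)) ∧
      (∀ h : H, ∃ c : ℚ, φ (fractionFieldEquiv G (monomialY G h)) =
        (c : fractionField G') * fractionFieldEquiv G' (monomialY G' (e h))) ∧
      IsPureAddSubgroup H ∧ IsPureAddSubgroup H' ∧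
      HasFreeComplement H k ∧ HasFreeComplement H' k := by
  have h0 := charZero_of_algebra_addMonoidAlgebra G (GroupRingFractions G)
  have h0' := charZero_of_algebra_addMonoidAlgebra G' (GroupRingFractions G')
  -- the same isomorphism, between the fields of fractions themselves
  let ψ : GroupRingFractions G ≃+* GroupRingFractions G' :=
    (fractionFieldEquiv G).trans (φ.trans (fractionFieldEquiv G').symm)
  have hψ : ∀ (c : ℚ) (g : G) (g' : G'),
      ψ (fieldMonomial (GroupRingFractions G) g) =
          (c : GroupRingFractions G') * fieldMonomial (GroupRingFractions G') g' ↔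
        φ (fractionFieldEquiv G (monomialY G g)) =
          (c : fractionField G') * fractionFieldEquiv G' (monomialY G' g') := by
    intro c g g'
    rw [← (fractionFieldEquiv G').injective.eq_iff, map_mul, map_ratCast]
    change fractionFieldEquiv G' ((fractionFieldEquiv G').symm
      (φ (fractionFieldEquiv G (monomialY G g)))) = _ ↔ _
    rw [RingEquiv.apply_symm_apply]
    rfl
  have hψ' : ∀ (c : ℚ) (g : G) (g' : G'),
      ψ.symm (fieldMonomial (GroupRingFractions G') g') =
          (c : GroupRingFractions G) * fieldMonomial (GroupRingFractions G) g ↔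
        φ.symm (fractionFieldEquiv G' (monomialY G' g')) =
          (c : fractionField G) * fractionFieldEquiv G (monomialY G g) := by
    intro c g g'
    rw [← (fractionFieldEquiv G).injective.eq_iff, map_mul, map_ratCast]
    change fractionFieldEquiv G ((fractionFieldEquiv G).symm
      (φ.symm (fractionFieldEquiv G' (monomialY G' g')))) = _ ↔ _
    rw [RingEquiv.apply_symm_apply]
    rfl
  obtain ⟨e, he⟩ := exists_monomialSubgroup_addEquiv (G := G) (G' := G') ψ
  obtain ⟨hpure, k, hk⟩ := monomialSubgroup_isPure_and_hasFreeComplement (G := G) (G' := G')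
    G.rank_eq G'.rank_eq ψ
  obtain ⟨hpure', k', hk'⟩ := monomialSubgroup_isPure_and_hasFreeComplement (G := G') (G' := G)
    G'.rank_eq G.rank_eq ψ.symm
  obtain rfl : k = k' := eq_of_hasFreeComplement G.rank_eq G'.rank_eq e hk hk'
  refine ⟨_, _, e, k, fun g => ?_, fun g' => ?_, fun h => ?_, hpure, hpure', hk, hk'⟩
  · rw [mem_monomialSubgroup]
    exact exists_congr fun c => exists_congr fun g' => hψ c g g'
  · rw [mem_monomialSubgroup]
    exact exists_congr fun c => exists_congr fun g => hψ' c g g'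
  · obtain ⟨c, hc⟩ := he h
    exact ⟨c, (hψ c h (e h)).1 hc⟩


theorem fractionFieldMap_refl {r : ℕ} (G : TFAb r) :
    fractionFieldMap G G (AddEquiv.refl G) = RingEquiv.refl (fractionField G) := by
  rw [fractionFieldMap, groupRingFractionsMap_refl]
  ext x
  exact (fractionFieldEquiv G).apply_symm_apply x

theorem RingEquiv.conj_trans {A B C A' B' C' : Type*} [Mul A] [Add A] [Mul B] [Add B] [Mul C]
    [Add C] [Mul A'] [Add A'] [Mul B'] [Add B'] [Mul C'] [Add C'] (a : A ≃+* A') (b : B ≃+* B')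
    (c : C ≃+* C') (f : A ≃+* B) (g : B ≃+* C) :
    a.symm.trans ((f.trans g).trans c) =
      (a.symm.trans (f.trans b)).trans (b.symm.trans (g.trans c)) := by
  ext x
  simp

theorem fractionFieldMap_trans {r : ℕ} (G G' G'' : TFAb r) (f : G ≃+ G') (g : G' ≃+ G'') :
    fractionFieldMap G G'' (f.trans g) =
      (fractionFieldMap G G' f).trans (fractionFieldMap G' G'' g) := by
  rw [fractionFieldMap, groupRingFractionsMap_trans]
  exact RingEquiv.conj_trans _ _ _ _ _

theorem fractionFieldMap_monomialY {r : ℕ} (G G' : TFAb r) (f : G ≃+ G') (g : G) :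
    fractionFieldMap G G' f (fractionFieldEquiv G (monomialY G g)) =
      fractionFieldEquiv G' (monomialY G' (f g)) := by
  rw [fractionFieldMap, RingEquiv.trans_apply, RingEquiv.trans_apply, RingEquiv.symm_apply_apply,
    groupRingFractionsMap_monomialY]

theorem nonempty_addEquiv_iff {r : ℕ} (G G' : TFAb r) :
    Nonempty (G ≃+ G') ↔ Nonempty (fractionField G ≃+* fractionField G') := by
  refine ⟨fun ⟨f⟩ => ⟨fractionFieldMap G G' f⟩, fun ⟨φ⟩ => ?_⟩
  obtain ⟨H, H', e, k, -, -, -, -, -, hk, hk'⟩ := exists_monomial_matching G G' φ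
  exact nonempty_addEquiv_of_hasFreeComplement e hk hk'

theorem isFunctorialTCEmbedding_fractionField {r : ℕ} {P Q : (ℕ → ℕ) → ℕ →. ℕ}
    (hP : ∀ (x : Σ r, TFAb r) (r n : ℕ),
      P x.2.diagram (Nat.pair r n) = Part.some ((fractionField x.2).diagram n))
    (hQ : ∀ (x : Σ r, Σ G G' : TFAb r, G ≃+ G') (r n : ℕ),
      Q (oracleJoin (oracleJoin x.2.1.diagram (TFAb.isoFun x.2.2.2)) x.2.2.1.diagram)
        (Nat.pair r n) = Part.some (FD.isoFun (fractionFieldMap x.2.1 x.2.2.1 x.2.2.2) n)) :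
    IsFunctorialTCEmbedding r P Q fractionField fractionFieldMap where
  computes_obj G n := hP ⟨r, G⟩ r n
  computes_map G G' f n := hQ ⟨r, G, G', f⟩ r n
  map_refl := fractionFieldMap_refl
  map_trans := fractionFieldMap_trans
  iso_iff := nonempty_addEquiv_iff

theorem mainTheorem1 :
    ∃ P Q : (ℕ → ℕ) → ℕ →. ℕ, IsTuringFunctional P ∧ IsTuringFunctional Q ∧
      ∀ r : ℕ, 0 < r →
        ∃ (Φ : TFAb r → FD r) (Φs : ∀ G G' : TFAb r, (G ≃+ G') → (Φ G ≃+* Φ G'))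
          (ι : ∀ G : TFAb r, GroupRingFractions G ≃+* Φ G),
          IsFunctorialTCEmbedding r P Q Φ Φs ∧
          (∀ (G G' : TFAb r) (f : G ≃+ G') (g : G),
            Φs G G' f (ι G (monomialY G g)) = ι G' (monomialY G' (f g))) ∧
          ∀ (G G' : TFAb r) (φ : Φ G ≃+* Φ G'),
            ∃ (H : AddSubgroup G) (H' : AddSubgroup G') (e : H ≃+ H') (k : ℕ),
              (∀ g : G, g ∈ H ↔ ∃ (c : ℚ) (g' : G'),
                φ (ι G (monomialY G g)) = (c : Φ G') * ι G' (monomialY G' g')) ∧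
              (∀ g' : G', g' ∈ H' ↔ ∃ (c : ℚ) (g : G),
                φ.symm (ι G' (monomialY G' g')) = (c : Φ G) * ι G (monomialY G g)) ∧
              (∀ h : H, ∃ c : ℚ,
                φ (ι G (monomialY G h)) = (c : Φ G') * ι G' (monomialY G' (e h))) ∧
              IsPureAddSubgroup H ∧ IsPureAddSubgroup H' ∧
              HasFreeComplement H k ∧ HasFreeComplement H' k := by
  -- the rank that comes with the input is not needed by the programs
  obtain ⟨P, hP, hPc⟩ := uniformlyComputable_fractionField_diagram.exists_functional_pair
  obtain ⟨Q, hQ, hQc⟩ := uniformlyComputable_fractionFieldMap.exists_functional_pair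
  exact ⟨P, Q, hP, hQ, fun r _ => ⟨fractionField, fractionFieldMap, fractionFieldEquiv,
    isFunctorialTCEmbedding_fractionField hPc hQc, fractionFieldMap_monomialY,
    exists_monomial_matching⟩⟩
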